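/- **Setting.** Let $(\Omega,\mathcal F)$ be a measurable space and $\mathscr H$ a linear space of real measurable functions on it such that $\varphi(X_1,\dots,X_n)\in\mathscr H$ for all $X_1,\dots,X_n\in\mathscr H$ and all $\varphi\in C_{l,Lip}(\mathbb R^n)$, i.e. $|\varphi(x)-\varphi(y)|\le C(1+|x|^m+|y|^m)|x-y|$ for some $C>0$, $m\in\mathbb N$. Let $\mathbb E:\mathscr H\to[-\infty,\infty]$ be a sub-linear expectation: it is monotone, $\mathbb E[c]=c$ for constants $c$, $\mathbb E[X+Y]\le\mathbb E[X]+\mathbb E[Y]$ whenever the right side is not of the form $\infty-\infty$ or $-\infty+\infty$, and $\mathbb E[\lambda X]=\lambda\mathbb E[X]$ for $\lambda\ge0$ (with $0\cdot\infty=0$). Put $\mathcal E[X]=-\mathbb E[-X]$. Let $\mathbb V:\mathcal F\to[0,1]$ be a sub-additive capacity ($\mathbb V(\emptyset)=0$, $\mathbb V(\Omega)=1$, $\mathbb V$ monotone, $\mathbb V(A\cup B)\le\mathbb V(A)+\mathbb V(B)$) such that $\mathbb E[f]\le\mathbb V(A)\le\mathbb E[g]$ whenever $A\in\mathcal F$,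 $f,g\in\mathscr H$ and $f\le I_A\le g$. Define $$\widehat{\mathbb V}(A)=\inf\{\mathbb E[\xi]: I_A\le\xi,\ \xi\in\mathscr H\},\qquad \widehat{\mathbb V}^*(A)=\inf\Big\{\sum_{n=1}^\infty\widehat{\mathbb V}(A_n): A\subset\bigcup_{n=1}^\infty A_n,\ A_n\in\mathcal F\Big\},\qquad A\in\mathcal F.$$ A random vector $\boldsymbol Y$ is independent to a random vector $\boldsymbol X$ (components in $\mathscr H$) if $\mathbb E[\varphi(\boldsymbol X,\boldsymbol Y)]=\mathbb E\big[\mathbb E[\varphi(x,\boldsymbol Y)]|_{x=\boldsymbol X}\big]$ for every $C_{l,Lip}$ function $\varphi$ with $\overline\varphi(x):=\mathbb E[|\varphi(x,\boldsymbol Y)|]<\infty$ for all $x$ and $\mathbb E[|\overline\varphi(\boldsymbol X)|]<\infty$ (the functions of $\boldsymbol X$ to which $\mathbb E$ is applied being in $\mathscr H$). A sequence $(X_n)_{n\ge1}$ is independent if $X_{i+1}$ is independent to $(X_1,\dots,X_i)$ for each $i\ge1$. Let $(X_n)_{n\ge1}$ be an independent sequence in $\mathscr H$, not necessarily identically distributed,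 with $\mathbb E[X_n^2]<\infty$ for all $n$. With $\log x=\ln\max(e,x)$, put $S_n=\sum_{k=1}^nX_k$, $s_n^2=\sum_{k=1}^n\mathbb E[X_k^2]$, $t_n=\sqrt{2\log\log s_n^2}$, $a_n=s_nt_n$ and $$\overline\Gamma_n(p,\alpha)=\mathbb E\Big[\big((|X_n|\wedge a_n-\alpha s_n/t_n)^+\big)^p\Big],\qquad \overline\Lambda_n(p,\alpha)=\sum_{j=1}^n\mathbb E\Big[\big((|X_j|\wedge a_n-\alpha s_n/t_n)^+\big)^p\Big].$$ **Theorem.** Assume that $s_n^2\to\infty$, that $\sum_{n=1}^\infty\mathbb V(|X_n|\ge\epsilon a_n)<\infty$ for all $\epsilon>0$, and that for every $\alpha>0$ there exist real numbers $p\ge2$ and $d\ge0$ such that $$\sum_{n=1}^\infty\frac{\overline\Gamma_n(p,\alpha)}{a_n^p}\Big(\frac{\overline\Lambda_n(p,\alpha)}{a_n^p}\Big)^d<\infty .$$ (Here $x^0=1$ for all $x\ge0$; the finitely many $n$ with $a_n=0$ are irrelevant.) Then: 1. for every $\epsilon>0$, $$\lim_{n\to\infty}\sup_N\mathbb V\Big(\inf_{n\le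 m\le N}\frac{S_m-\mathcal E[S_m]}{a_m}<-1-\epsilon\ \text{ or }\ \sup_{n\le m\le N}\frac{S_m-\mathbb E[S_m]}{a_m}>1+\epsilon\Big)=0;$$ 2. if $\mathbb V$ is countably sub-additive, i.e. $\mathbb V(\bigcup_nA_n)\le\sum_n\mathbb V(A_n)$ for all $A_n\in\mathcal F$, then for every $\epsilon>0$, $$\lim_{n\to\infty}\mathbb V\Big(\inf_{m\ge n}\frac{S_m-\mathcal E[S_m]}{a_m}<-1-\epsilon\ \text{ or }\ \sup_{m\ge n}\frac{S_m-\mathbb E[S_m]}{a_m}>1+\epsilon\Big)=0;$$ 3. in all cases, $$\widehat{\mathbb V}^*\Big(\liminf_{n\to\infty}\frac{S_n-\mathcal E[S_n]}{a_n}<-1\ \text{ or }\ \limsup_{n\to\infty}\frac{S_n-\mathbb E[S_n]}{a_n}>1\Big)=0.$$ -/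

import Mathlib

open Filter Topology
open scoped ENNReal

/-- Locally Lipschitz functions of polynomial growth, the class `C_{l,Lip}`.
(On a finite-dimensional space the class does not depend on the choice of the norm.) -/
def LocLip {F : Type*} [SeminormedAddCommGroup F] (φ : F → ℝ) : Prop :=
  ∃ C : ℝ, 0 < C ∧ ∃ m : ℕ, ∀ x y : F,
    |φ x - φ y| ≤ C * (1 + ‖x‖ ^ m + ‖y‖ ^ m) * ‖x - y‖

/-- A sub-linear expectation space `(Ω, H, E)` over a measurable space `Ω`: `H` is a linear space
of measurable real functions stable under composition with `C_{l,Lip}` functions, and `E` is a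
sub-linear expectation on `H` with values in `[-∞, ∞]`.
Only the values of `E` on `H` are meaningful. In `EReal` one has `0 * ⊤ = 0`. -/
structure SublinearExpectation (Ω : Type*) [MeasurableSpace Ω] where
  /-- the space of random variables -/
  H : Submodule ℝ (Ω → ℝ)
  /-- the sub-linear expectation -/
  E : (Ω → ℝ) → EReal
  measurable_of_mem : ∀ X ∈ H, Measurable X
  comp_mem : ∀ (n : ℕ) (X : Fin n → Ω → ℝ) (φ : (Fin n → ℝ) → ℝ),
    (∀ i, X i ∈ H) → LocLip φ → (fun ω => φ (fun i => X i ω)) ∈ H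
  mono : ∀ X ∈ H, ∀ Y ∈ H, (∀ ω, Y ω ≤ X ω) → E Y ≤ E X
  const : ∀ c : ℝ, E (fun _ => c) = (c : EReal)
  subadd : ∀ X ∈ H, ∀ Y ∈ H, ¬ (E X = ⊤ ∧ E Y = ⊥) → ¬ (E X = ⊥ ∧ E Y = ⊤) →
    E (fun ω => X ω + Y ω) ≤ E X + E Y
  pos_homog : ∀ X ∈ H, ∀ c : ℝ, 0 ≤ c → E (fun ω => c * X ω) = (c : EReal) * E X

/-- A capacity on the measurable sets, with values in `[0, 1]` (because `V Ω = 1`). -/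
structure IsCapacity {Ω : Type*} [MeasurableSpace Ω] (V : Set Ω → ℝ≥0∞) : Prop where
  empty : V ∅ = 0
  univ : V Set.univ = 1
  mono : ∀ A B : Set Ω, MeasurableSet A → MeasurableSet B → A ⊆ B → V A ≤ V B

/-- Sub-additivity on the measurable sets. -/
def IsSubadditiveCap {Ω : Type*} [MeasurableSpace Ω] (V : Set Ω → ℝ≥0∞) : Prop :=
  ∀ A B : Set Ω, MeasurableSet A → MeasurableSet B → V (A ∪ B) ≤ V A + V B

/-- Countable sub-additivity on the measurable sets. -/
def IsCountablySubadditiveCap {Ω : Type*} [MeasurableSpace Ω] (V : Set Ω → ℝ≥0∞) : Prop :=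
  ∀ A : ℕ → Set Ω, (∀ n, MeasurableSet (A n)) → V (⋃ n, A n) ≤ ∑' n, V (A n)

namespace SublinearExpectation

variable {Ω : Type*} [MeasurableSpace Ω] (𝓔 : SublinearExpectation Ω)

/-- The upper expectation as a real number, used where it is finite. -/
noncomputable def ex (X : Ω → ℝ) : ℝ := (𝓔.E X).toReal

/-- The conjugate expectation `-E[-X]` as a real number, used where it is finite. -/
noncomputable def cex (X : Ω → ℝ) : ℝ := -(𝓔.E (fun ω => -X ω)).toReal

/-- The random vector `Y` is independent to the random vector `X`:
`E[φ(X, Y)] = E[E[φ(x, Y)]|_{x = X}]` for all test functions `φ` in `C_{l,Lip}` such that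
`φ̄(x) = E[|φ(x, Y)|]` is finite for all `x` and `E[|φ̄(X)|]` is finite. The identity is only
required when the functions of `X` to which `E` is applied are random variables in `H`. -/
def IndepTo {m n : ℕ} (Y : Fin n → Ω → ℝ) (X : Fin m → Ω → ℝ) : Prop :=
  ∀ φ : (Fin m → ℝ) × (Fin n → ℝ) → ℝ, LocLip φ →
    (∀ x : Fin m → ℝ, 𝓔.E (fun ω => |φ (x, fun j => Y j ω)|) < ⊤) →
    (fun ω => 𝓔.ex (fun ω' => |φ (fun i => X i ω, fun j => Y j ω')|)) ∈ 𝓔.H →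
    (fun ω => 𝓔.ex (fun ω' => φ (fun i => X i ω, fun j => Y j ω'))) ∈ 𝓔.H →
    𝓔.E (fun ω => |𝓔.ex (fun ω' => |φ (fun i => X i ω, fun j => Y j ω')|)|) < ⊤ →
    𝓔.E (fun ω => φ (fun i => X i ω, fun j => Y j ω)) =
      𝓔.E (fun ω => 𝓔.ex (fun ω' => φ (fun i => X i ω, fun j => Y j ω')))

/-- The sequence `X 1, X 2, …` of random variables is independent: `X (i + 1)` is independent to
`(X 1, …, X i)` for every `i ≥ 1`. The value `X 0` is not used. -/
def IndepSeq (X : ℕ → Ω → ℝ) : Prop :=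
  ∀ i : ℕ, 1 ≤ i →
    𝓔.IndepTo (fun _ : Fin 1 => X (i + 1)) (fun j : Fin i => X (j + 1))

/-- `E[f] ≤ V(A) ≤ E[g]` whenever `f ≤ I_A ≤ g` with `f, g ∈ H` and `A` measurable. -/
def Dominates (V : Set Ω → ℝ≥0∞) : Prop :=
  ∀ A : Set Ω, MeasurableSet A → ∀ f ∈ 𝓔.H, ∀ g ∈ 𝓔.H,
    (∀ ω, f ω ≤ A.indicator (fun _ => (1 : ℝ)) ω) →
    (∀ ω, A.indicator (fun _ => (1 : ℝ)) ω ≤ g ω) →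
    𝓔.E f ≤ (V A : EReal) ∧ (V A : EReal) ≤ 𝓔.E g

/-- The largest upper capacity `V̂(A) = inf {E[ξ] : I_A ≤ ξ, ξ ∈ H}`
(the infimum is over nonnegative numbers). -/
noncomputable def upperCap (A : Set Ω) : ℝ≥0∞ :=
  (⨅ ξ ∈ {ξ : Ω → ℝ | ξ ∈ 𝓔.H ∧ ∀ ω, A.indicator (fun _ => (1 : ℝ)) ω ≤ ξ ω},
    𝓔.E ξ).toENNReal

/-- The countably sub-additive extension
`V̂*(A) = inf {∑ₙ V̂(Aₙ) : A ⊆ ⋃ₙ Aₙ, Aₙ measurable}` of `V̂`. -/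
noncomputable def outerCap (A : Set Ω) : ℝ≥0∞ :=
  ⨅ B ∈ {B : ℕ → Set Ω | (∀ n, MeasurableSet (B n)) ∧ A ⊆ ⋃ n, B n},
    ∑' n, 𝓔.upperCap (B n)

end SublinearExpectation

/-- The convention `log x = ln (max (e, x))`. -/
noncomputable def logE (x : ℝ) : ℝ := Real.log (max (Real.exp 1) x)

/-- `S_n = X_1 + ⋯ + X_n`. -/
def partialSum {Ω : Type*} (X : ℕ → Ω → ℝ) (n : ℕ) (ω : Ω) : ℝ :=
  ∑ k ∈ Finset.Icc 1 n, X k ω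

namespace SublinearExpectation

variable {Ω : Type*} [MeasurableSpace Ω] (𝓔 : SublinearExpectation Ω) (X : ℕ → Ω → ℝ)

/-- `s_n² = ∑_{k=1}^n E[X_k²]`. -/
noncomputable def sSq (n : ℕ) : ℝ := ∑ k ∈ Finset.Icc 1 n, 𝓔.ex (fun ω => X k ω ^ 2)

/-- `s_n`. -/
noncomputable def s (n : ℕ) : ℝ := Real.sqrt (𝓔.sSq X n)

/-- `t_n = √(2 log log s_n²)`. -/
noncomputable def t (n : ℕ) : ℝ := Real.sqrt (2 * logE (logE (𝓔.sSq X n)))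

/-- `a_n = s_n t_n`. -/
noncomputable def a (n : ℕ) : ℝ := 𝓔.s X n * 𝓔.t X n

/-- `E[((|X_j| ∧ a_n - α s_n / t_n)⁺)^p]`. -/
noncomputable def truncMoment (p α : ℝ) (n j : ℕ) : ℝ :=
  𝓔.ex (fun ω => (max (min |X j ω| (𝓔.a X n) - α * 𝓔.s X n / 𝓔.t X n) 0) ^ p)

/-- `Γ̄_n(p, α)`. -/
noncomputable def GammaBar (p α : ℝ) (n : ℕ) : ℝ := 𝓔.truncMoment X p α n n

/-- `Λ̄_n(p, α)`. -/
noncomputable def LambdaBar (p α : ℝ) (n : ℕ) : ℝ :=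
  ∑ j ∈ Finset.Icc 1 n, 𝓔.truncMoment X p α n j

/-- `(S_m - 𝓔[S_m]) / a_m`, centred by the conjugate expectation, as an extended real. -/
noncomputable def lowerRatio (m : ℕ) (ω : Ω) : EReal :=
  (((partialSum X m ω - 𝓔.cex (partialSum X m)) / 𝓔.a X m : ℝ) : EReal)

/-- `(S_m - E[S_m]) / a_m`, centred by the upper expectation, as an extended real. -/
noncomputable def upperRatio (m : ℕ) (ω : Ω) : EReal :=
  (((partialSum X m ω - 𝓔.ex (partialSum X m)) / 𝓔.a X m : ℝ) : EReal)

end SublinearExpectation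

/-! The proof is a Chernoff bound along geometric blocks of `s_n^2`, carried out throughout for
`upperCap`, which dominates `V` and generates `outerCap`.

Independence enters twice. It makes the upper expectation additive on partial sums
(`ex_partialSum`), and it turns a product of factors of upper expectation at most one into a
supermartingale. Indicators of stopping events need not lie in `H`, so first passage is smoothed by
Lipschitz ramps; this yields the maximal inequality `upperCap_exists_runProd_le`, at the price of a
factor 2.

The variables are cut off above at `δ a_j`, which the tail series pays for. The exponential moment
of a truncated variable is bounded by a quadratic part, responsible for the iterated logarithm, plus
a multiple of the `p`-th moment of the excess over a level of order `s_n / t_n`. With `r = excessSum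
/ a_n^p`, the rate is `t_n / s_n` when `r` is tiny and smaller otherwise (`exists_rate`). Up to a
constant, the probability of exceeding `(1 + ε) a_n` up to time `n` is then at most `exp (-(1 + ε)
log log s_n^2) + r^(d+1)` (`exists_upperCap_truncSum_le`). At block ends the first term is a
convergent `k`-series. The second is summable by a Kronecker-type argument, because the increments
of `excessSum^(d+1)` are at most `(d+1) Γ Λ^d` (`excessSum_rpow_le`, `tsum_blockEnd_lt_top`).

The exceptional events are thus covered by measurable sets of small total `upperCap`, finitely many
for each time (`HasCover`). Finite sub-additivity of `V`, countable sub-additivity of `V` and the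
definition of `outerCap` turn this one statement into the three conclusions. The lower half is the
upper half for `-X`. -/

/-! ### Finite sub-linear expectations and the upper capacity. -/

namespace SublinearExpectation

/-- The ramp from `0` on `(-∞, c / 2]` to `1` on `[c, ∞)`. -/
noncomputable def ramp (c u : ℝ) : ℝ := min (max (2 / c * u - 1) 0) 1

theorem ramp_nonneg (c u : ℝ) : 0 ≤ ramp c u := le_min (le_max_right _ _) zero_le_one

theorem ramp_le_one (c u : ℝ) : ramp c u ≤ 1 := min_le_right _ _

theorem ramp_of_le {c u : ℝ} (hc : 0 < c) (h : c ≤ u) : ramp c u = 1 := by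
  have : 2 ≤ 2 / c * u := by rw [div_mul_eq_mul_div, le_div_iff₀ hc]; linarith
  exact min_eq_right (le_max_of_le_left (by linarith))

theorem ramp_of_le_half {c u : ℝ} (hc : 0 < c) (h : u ≤ c / 2) : ramp c u = 0 := by
  have : 2 / c * u ≤ 1 := by rw [div_mul_eq_mul_div, div_le_one hc]; linarith
  rw [ramp, max_eq_right (by linarith), min_eq_left zero_le_one]

theorem abs_ramp_sub_le {c : ℝ} (hc : 0 < c) (u v : ℝ) :
    |ramp c u - ramp c v| ≤ 2 / c * |u - v| := by
  have h1 := abs_min_sub_min_le_max (max (2 / c * u - 1) 0) 1 (max (2 / c * v - 1) 0) 1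
  have h2 := abs_max_sub_max_le_max (2 / c * u - 1) 0 (2 / c * v - 1) 0
  simp only [sub_self, abs_zero, abs_nonneg, sup_of_le_left] at h1 h2
  have h3 : 2 / c * u - 1 - (2 / c * v - 1) = 2 / c * (u - v) := by ring
  rw [h3, abs_mul, abs_of_pos (by positivity : 0 < 2 / c)] at h2
  exact h1.trans h2

variable {Ω : Type*} [MeasurableSpace Ω] {𝓔 : SublinearExpectation Ω}

theorem comp_real_mem {X : Ω → ℝ} (hX : X ∈ 𝓔.H) {f : ℝ → ℝ} (hf : LocLip f) :
    (fun ω => f (X ω)) ∈ 𝓔.H := by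
  refine 𝓔.comp_mem 1 (fun _ => X) (fun v => f (v 0)) (fun _ => hX) ?_
  obtain ⟨C, hC, m, h⟩ := hf
  refine ⟨C, hC, m, fun x y => (h _ _).trans ?_⟩
  have h1 : ‖x 0‖ ≤ ‖x‖ := norm_le_pi_norm x 0
  have h2 : ‖y 0‖ ≤ ‖y‖ := norm_le_pi_norm y 0
  have h3 : ‖x 0 - y 0‖ ≤ ‖x - y‖ := norm_le_pi_norm (x - y) 0
  gcongr

theorem locLip_of_lipschitz {F : Type*} [SeminormedAddCommGroup F] {f : F → ℝ} {L : ℝ}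
    (h : ∀ x y, |f x - f y| ≤ L * ‖x - y‖) : LocLip f := by
  refine ⟨|L| + 1, by positivity, 0, fun x y => (h x y).trans ?_⟩
  have h1 : L ≤ (|L| + 1) * (1 + ‖x‖ ^ 0 + ‖y‖ ^ 0) := by
    simp only [pow_zero]
    nlinarith [le_abs_self L, abs_nonneg L]
  gcongr

theorem comp_lipschitz_mem {X : Ω → ℝ} (hX : X ∈ 𝓔.H) {f : ℝ → ℝ} {L : ℝ}
    (h : ∀ x y, |f x - f y| ≤ L * |x - y|) : (fun ω => f (X ω)) ∈ 𝓔.H :=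
  comp_real_mem hX (locLip_of_lipschitz h)

theorem const_mem (c : ℝ) : (fun _ : Ω => c) ∈ 𝓔.H :=
  comp_lipschitz_mem (f := fun _ => c) (L := 0) 𝓔.H.zero_mem (by simp)

theorem abs_mem {X : Ω → ℝ} (hX : X ∈ 𝓔.H) : (fun ω => |X ω|) ∈ 𝓔.H :=
  comp_lipschitz_mem (f := fun x => |x|) (L := 1) hX
    (fun x y => by rw [one_mul]; exact abs_abs_sub_abs_le_abs_sub x y)

theorem add_mem' {X Y : Ω → ℝ} (hX : X ∈ 𝓔.H) (hY : Y ∈ 𝓔.H) : (fun ω => X ω + Y ω) ∈ 𝓔.H :=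
  𝓔.H.add_mem hX hY

theorem const_mul_mem {X : Ω → ℝ} (c : ℝ) (hX : X ∈ 𝓔.H) : (fun ω => c * X ω) ∈ 𝓔.H :=
  𝓔.H.smul_mem c hX

theorem neg_mem' {X : Ω → ℝ} (hX : X ∈ 𝓔.H) : (fun ω => -X ω) ∈ 𝓔.H :=
  𝓔.H.neg_mem hX

theorem sq_mem {X : Ω → ℝ} (hX : X ∈ 𝓔.H) : (fun ω => X ω ^ 2) ∈ 𝓔.H := by
  refine comp_real_mem (f := fun x => x ^ 2) hX ⟨1, one_pos, 1, fun x y => ?_⟩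
  have : x ^ 2 - y ^ 2 = (x + y) * (x - y) := by ring
  rw [this, abs_mul, Real.norm_eq_abs, Real.norm_eq_abs, Real.norm_eq_abs]
  gcongr
  have := abs_add_le x y
  linarith

/-- Random variables with finite upper expectation of the absolute value. -/
structure Integ (𝓔 : SublinearExpectation Ω) (X : Ω → ℝ) : Prop where
  mem : X ∈ 𝓔.H
  lt_top : 𝓔.E (fun ω => |X ω|) < ⊤

namespace Integ

variable {X Y : Ω → ℝ}

theorem E_lt_top (hX : 𝓔.Integ X) : 𝓔.E X < ⊤ :=
  (𝓔.mono _ (abs_mem hX.mem) _ hX.mem fun _ => le_abs_self _).trans_lt hX.lt_top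

theorem E_neg_lt_top (hX : 𝓔.Integ X) : 𝓔.E (fun ω => -X ω) < ⊤ :=
  (𝓔.mono _ (abs_mem hX.mem) _ (neg_mem' hX.mem) fun _ => neg_le_abs _).trans_lt hX.lt_top

/-- Otherwise `0 = E[X + (-X)] ≤ E[X] + E[-X] = ⊥`, the sum being admissible because `E[-X] < ⊤`. -/
theorem E_ne_bot (hX : 𝓔.Integ X) : 𝓔.E X ≠ ⊥ := by
  intro h
  have h1 := hX.E_neg_lt_top
  have := 𝓔.subadd X hX.mem _ (neg_mem' hX.mem) (by simp [h]) (fun h2 => h1.ne h2.2)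
  simp only [add_neg_cancel, h, 𝓔.const, EReal.bot_add, le_bot_iff] at this
  exact EReal.coe_ne_bot _ this

theorem E_eq (hX : 𝓔.Integ X) : 𝓔.E X = (𝓔.ex X : EReal) :=
  (EReal.coe_toReal hX.E_lt_top.ne hX.E_ne_bot).symm

theorem of_le (hX : 𝓔.Integ X) (hY : Y ∈ 𝓔.H) (h : ∀ ω, |Y ω| ≤ X ω) : 𝓔.Integ Y :=
  ⟨hY, (𝓔.mono _ hX.mem _ (abs_mem hY) h).trans_lt hX.E_lt_top⟩

theorem const (c : ℝ) : 𝓔.Integ (fun _ => c) :=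
  ⟨const_mem c, by rw [𝓔.const]; exact EReal.coe_lt_top _⟩

theorem of_bdd (hY : Y ∈ 𝓔.H) (c : ℝ) (h : ∀ ω, |Y ω| ≤ c) : 𝓔.Integ Y :=
  (Integ.const c).of_le hY h

theorem abs (hX : 𝓔.Integ X) : 𝓔.Integ (fun ω => |X ω|) :=
  ⟨abs_mem hX.mem, by simpa only [abs_abs] using hX.lt_top⟩

theorem neg (hX : 𝓔.Integ X) : 𝓔.Integ (fun ω => -X ω) :=
  ⟨neg_mem' hX.mem, by simpa only [abs_neg] using hX.lt_top⟩

theorem E_add_le (hX : 𝓔.Integ X) (hY : 𝓔.Integ Y) :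
    𝓔.E (fun ω => X ω + Y ω) ≤ 𝓔.E X + 𝓔.E Y :=
  𝓔.subadd X hX.mem Y hY.mem (fun h => hX.E_lt_top.ne h.1) (fun h => hY.E_lt_top.ne h.2)

theorem add (hX : 𝓔.Integ X) (hY : 𝓔.Integ Y) : 𝓔.Integ (fun ω => X ω + Y ω) := by
  refine ⟨add_mem' hX.mem hY.mem, ?_⟩
  have h1 := 𝓔.mono _ (add_mem' hX.abs.mem hY.abs.mem) _ (abs_mem (add_mem' hX.mem hY.mem))
    (fun ω => abs_add_le (X ω) (Y ω))
  refine (h1.trans (hX.abs.E_add_le hY.abs)).trans_lt ?_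
  rw [hX.abs.E_eq, hY.abs.E_eq, ← EReal.coe_add]
  exact EReal.coe_lt_top _

theorem sub (hX : 𝓔.Integ X) (hY : 𝓔.Integ Y) : 𝓔.Integ (fun ω => X ω - Y ω) := by
  simpa only [sub_eq_add_neg] using hX.add hY.neg

theorem const_mul (c : ℝ) (hX : 𝓔.Integ X) : 𝓔.Integ (fun ω => c * X ω) := by
  refine ⟨const_mul_mem c hX.mem, ?_⟩
  simp only [abs_mul]
  rw [𝓔.pos_homog _ hX.abs.mem _ (abs_nonneg c), hX.abs.E_eq, ← EReal.coe_mul]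
  exact EReal.coe_lt_top _

theorem sum {ι : Type*} {s : Finset ι} {X : ι → Ω → ℝ} (hX : ∀ i ∈ s, 𝓔.Integ (X i)) :
    𝓔.Integ (fun ω => ∑ i ∈ s, X i ω) := by
  classical
  induction s using Finset.induction_on with
  | empty => simpa using Integ.const 0
  | insert i s hi ih =>
    simp only [Finset.sum_insert hi]
    exact (hX i (by simp)).add (ih fun j hj => hX j (by simp [hj]))

theorem of_sq (hX : X ∈ 𝓔.H) (h : 𝓔.E (fun ω => X ω ^ 2) < ⊤) :
    𝓔.Integ X ∧ 𝓔.Integ (fun ω => X ω ^ 2) := by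
  have h2 : 𝓔.Integ (fun ω => X ω ^ 2) := ⟨sq_mem hX, by simpa using h⟩
  refine ⟨(h2.add (Integ.const 1)).of_le hX fun ω => ?_, h2⟩
  rw [← sq_abs]
  nlinarith [sq_nonneg (|X ω| - 1), abs_nonneg (X ω)]

end Integ

variable {X Y : Ω → ℝ}

theorem ex_const (c : ℝ) : 𝓔.ex (fun _ => c) = c := by
  simp [ex, 𝓔.const]

theorem ex_mono (hX : 𝓔.Integ X) (hY : 𝓔.Integ Y) (h : ∀ ω, X ω ≤ Y ω) : 𝓔.ex X ≤ 𝓔.ex Y := by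
  have := 𝓔.mono _ hY.mem _ hX.mem h
  rwa [hX.E_eq, hY.E_eq, EReal.coe_le_coe_iff] at this

theorem ex_nonneg (hX : 𝓔.Integ X) (h : ∀ ω, 0 ≤ X ω) : 0 ≤ 𝓔.ex X := by
  have := ex_mono (Integ.const 0) hX h
  rwa [ex_const] at this

theorem ex_add_le (hX : 𝓔.Integ X) (hY : 𝓔.Integ Y) :
    𝓔.ex (fun ω => X ω + Y ω) ≤ 𝓔.ex X + 𝓔.ex Y := by
  have := hX.E_add_le hY
  rwa [hX.E_eq, hY.E_eq, (hX.add hY).E_eq, ← EReal.coe_add, EReal.coe_le_coe_iff] at this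

theorem ex_const_mul (hX : 𝓔.Integ X) {c : ℝ} (hc : 0 ≤ c) :
    𝓔.ex (fun ω => c * X ω) = c * 𝓔.ex X := by
  have := 𝓔.pos_homog X hX.mem c hc
  rwa [hX.E_eq, (hX.const_mul c).E_eq, ← EReal.coe_mul, EReal.coe_eq_coe_iff] at this

/-- Sub-additivity gives one inequality, and adding back `-c` gives the other. This exact
translation rule is what makes inner expectations under independence computable. -/
theorem ex_add_const (hX : 𝓔.Integ X) (c : ℝ) : 𝓔.ex (fun ω => X ω + c) = 𝓔.ex X + c := by
  apply le_antisymm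
  · simpa [ex_const] using ex_add_le hX (Integ.const c)
  · have := ex_add_le (hX.add (Integ.const c)) (Integ.const (-c))
    simp only [ex_const, add_neg_cancel_right] at this
    linarith

theorem ex_abs_sub_le (hX : 𝓔.Integ X) (hY : 𝓔.Integ Y) :
    |𝓔.ex X - 𝓔.ex Y| ≤ 𝓔.ex (fun ω => |X ω - Y ω|) := by
  have key : ∀ {X Y : Ω → ℝ}, 𝓔.Integ X → 𝓔.Integ Y →
      𝓔.ex X ≤ 𝓔.ex Y + 𝓔.ex (fun ω => |X ω - Y ω|) := by
    intro X Y hX hY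
    refine (ex_mono hX (hY.add (hX.sub hY).abs) fun ω => ?_).trans
      (ex_add_le hY (hX.sub hY).abs)
    linarith [le_abs_self (X ω - Y ω)]
  have h1 := key hX hY
  have h2 := key hY hX
  simp only [abs_sub_comm (Y _)] at h2
  rw [abs_le]
  constructor <;> linarith

theorem upperCap_le {A : Set Ω} {ξ : Ω → ℝ} (hξ : ξ ∈ 𝓔.H)
    (h : ∀ ω, A.indicator (fun _ => (1 : ℝ)) ω ≤ ξ ω) : 𝓔.upperCap A ≤ (𝓔.E ξ).toENNReal :=
  EReal.toENNReal_le_toENNReal (iInf₂_le ξ ⟨hξ, h⟩)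

theorem upperCap_le_ofReal {A : Set Ω} {ξ : Ω → ℝ} (hξ : 𝓔.Integ ξ)
    (h : ∀ ω, A.indicator (fun _ => (1 : ℝ)) ω ≤ ξ ω) :
    𝓔.upperCap A ≤ ENNReal.ofReal (𝓔.ex ξ) := by
  have := upperCap_le hξ.mem h
  rwa [hξ.E_eq, EReal.toENNReal_of_ne_top (EReal.coe_ne_top _), EReal.toReal_coe] at this

theorem upperCap_mono {A B : Set Ω} (h : A ⊆ B) : 𝓔.upperCap A ≤ 𝓔.upperCap B :=
  EReal.toENNReal_le_toENNReal (le_iInf₂ fun ξ hξ => iInf₂_le ξ ⟨hξ.1, fun ω =>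
    (Set.indicator_le_indicator_of_subset h (fun _ => zero_le_one) ω).trans (hξ.2 ω)⟩)

theorem upperCap_le_one (A : Set Ω) : 𝓔.upperCap A ≤ 1 := by
  have := upperCap_le_ofReal (𝓔 := 𝓔) (A := A) (Integ.const 1)
    (fun ω => Set.indicator_le_self' (fun _ _ => zero_le_one) ω)
  simpa [ex_const] using this

theorem upperCap_empty : 𝓔.upperCap ∅ = 0 := by
  have := upperCap_le_ofReal (𝓔 := 𝓔) (A := ∅) (Integ.const 0) (fun ω => by simp)
  simpa [ex_const] using this

theorem Dominates.le_upperCap {V : Set Ω → ℝ≥0∞} (h : 𝓔.Dominates V) {A : Set Ω}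
    (hA : MeasurableSet A) : V A ≤ 𝓔.upperCap A := by
  have : (V A : EReal) ≤ ⨅ ξ ∈ {ξ : Ω → ℝ | ξ ∈ 𝓔.H ∧
      ∀ ω, A.indicator (fun _ => (1 : ℝ)) ω ≤ ξ ω}, 𝓔.E ξ :=
    le_iInf₂ fun ξ hξ => (h A hA (fun _ => 0) (const_mem 0) ξ hξ.1
      (Set.indicator_nonneg fun _ _ => zero_le_one) hξ.2).2
  simpa [upperCap] using EReal.toENNReal_le_toENNReal this

/-- Markov's inequality for the upper capacity. -/
theorem upperCap_le_div (hX : 𝓔.Integ X) {c : ℝ} (hc : 0 < c) {A : Set Ω}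
    (hA : ∀ ω ∈ A, c ≤ X ω) (h0 : ∀ ω, 0 ≤ X ω) :
    𝓔.upperCap A ≤ ENNReal.ofReal (𝓔.ex X / c) := by
  have h := upperCap_le_ofReal (A := A) (hX.const_mul c⁻¹) (fun ω => by
    by_cases h : ω ∈ A
    · rw [Set.indicator_of_mem h, inv_mul_eq_div, one_le_div hc]
      exact hA ω h
    · rw [Set.indicator_of_notMem h]
      exact mul_nonneg (by positivity) (h0 ω))
  rwa [ex_const_mul hX (by positivity), inv_mul_eq_div] at h

/-- The upper capacity of a tail event is bounded by any dominated capacity of a larger one. -/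
theorem Dominates.upperCap_tail_le {V : Set Ω → ℝ≥0∞} (h : 𝓔.Dominates V) (hX : X ∈ 𝓔.H)
    {c : ℝ} (hc : 0 < c) :
    𝓔.upperCap {ω | c < |X ω|} ≤ V {ω | c / 2 ≤ |X ω|} := by
  have hm : (fun ω => ramp c |X ω|) ∈ 𝓔.H :=
    comp_lipschitz_mem (f := ramp c) (abs_mem hX) (abs_ramp_sub_le hc)
  have hA : MeasurableSet {ω | c / 2 ≤ |X ω|} :=
    measurableSet_le measurable_const (𝓔.measurable_of_mem _ (abs_mem hX))
  have h1 := (h _ hA _ hm (fun _ => 1) (const_mem 1) (fun ω => ?_)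
    (fun ω => Set.indicator_le_self' (fun _ _ => zero_le_one) ω)).1
  · refine (upperCap_le hm fun ω => ?_).trans
      ((EReal.toENNReal_le_toENNReal h1).trans (by simp))
    by_cases hω : ω ∈ {ω | c < |X ω|}
    · rw [Set.indicator_of_mem hω, ramp_of_le hc (le_of_lt hω)]
    · rw [Set.indicator_of_notMem hω]
      exact ramp_nonneg _ _
  · by_cases hω : ω ∈ {ω | c / 2 ≤ |X ω|}
    · rw [Set.indicator_of_mem hω]
      exact ramp_le_one _ _
    · rw [Set.indicator_of_notMem hω, ramp_of_le_half hc (not_le.mp hω).le]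

end SublinearExpectation

/-! ### A maximal inequality for products of independent factors. -/

namespace SublinearExpectation

/-- Nonnegative bounded functions that are Lipschitz in the coordinates `1, …, i`. -/
structure BLip (i : ℕ) (A : (ℕ → ℝ) → ℝ) : Prop where
  nonneg : ∀ x, 0 ≤ A x
  bdd : ∃ M, ∀ x, A x ≤ M
  lip : ∃ L, 0 ≤ L ∧ ∀ x y, |A x - A y| ≤ L * ∑ j ∈ Finset.Icc 1 i, |x j - y j|

namespace BLip

variable {i : ℕ} {A B : (ℕ → ℝ) → ℝ}

theorem const {c : ℝ} (hc : 0 ≤ c) : BLip i (fun _ => c) :=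
  ⟨fun _ => hc, ⟨c, fun _ => le_rfl⟩, 0, le_rfl, by simp⟩

theorem mono {k : ℕ} (hik : i ≤ k) (h : BLip i A) : BLip k A := by
  obtain ⟨L, hL, h1⟩ := h.lip
  refine ⟨h.nonneg, h.bdd, L, hL, fun x y => (h1 x y).trans ?_⟩
  gcongr

theorem add (hA : BLip i A) (hB : BLip i B) : BLip i (fun x => A x + B x) := by
  obtain ⟨L, hL, h1⟩ := hA.lip
  obtain ⟨L', hL', h1'⟩ := hB.lip
  obtain ⟨M, hM⟩ := hA.bdd
  obtain ⟨M', hM'⟩ := hB.bdd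
  refine ⟨fun x => add_nonneg (hA.nonneg x) (hB.nonneg x), ⟨M + M', fun x => add_le_add (hM x) (hM' x)⟩,
    L + L', by positivity, fun x y => ?_⟩
  rw [add_sub_add_comm, add_mul]
  exact (abs_add_le _ _).trans (add_le_add (h1 x y) (h1' x y))

theorem mul (hA : BLip i A) (hB : BLip i B) : BLip i (fun x => A x * B x) := by
  obtain ⟨L, hL, h1⟩ := hA.lip
  obtain ⟨L', hL', h1'⟩ := hB.lip
  obtain ⟨M, hM⟩ := hA.bdd
  obtain ⟨M', hM'⟩ := hB.bdd
  have hM0 : 0 ≤ M := (hA.nonneg 0).trans (hM 0)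
  have hM0' : 0 ≤ M' := (hB.nonneg 0).trans (hM' 0)
  refine ⟨fun x => mul_nonneg (hA.nonneg x) (hB.nonneg x),
    ⟨M * M', fun x => mul_le_mul (hM x) (hM' x) (hB.nonneg x) hM0⟩,
    M * L' + L * M', by positivity, fun x y => ?_⟩
  have h : A x * B x - A y * B y = A x * (B x - B y) + (A x - A y) * B y := by ring
  rw [h, add_mul]
  refine (abs_add_le _ _).trans ?_
  rw [abs_mul, abs_mul, abs_of_nonneg (hA.nonneg x), abs_of_nonneg (hB.nonneg y), mul_assoc,
    mul_right_comm]
  exact add_le_add (mul_le_mul (hM x) (h1' x y) (abs_nonneg _) hM0)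
    (mul_le_mul (h1 x y) (hM' y) (hB.nonneg y) (by positivity))

/-- Composition with a nonnegative bounded Lipschitz function of one variable. -/
theorem comp (hA : BLip i A) {f : ℝ → ℝ} (h0 : ∀ u, 0 ≤ f u) {M : ℝ} (hM : ∀ u, f u ≤ M) {K : ℝ}
    (hK : ∀ u v, |f u - f v| ≤ K * |u - v|) : BLip i (fun x => f (A x)) := by
  obtain ⟨L, hL, h1⟩ := hA.lip
  have hK0 : 0 ≤ K := by simpa using (abs_nonneg _).trans (hK 1 0)
  refine ⟨fun x => h0 _, ⟨M, fun x => hM _⟩, K * L, by positivity, fun x y => ?_⟩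
  rw [mul_assoc]
  exact (hK _ _).trans (by gcongr; exact h1 x y)

theorem coord {k : ℕ} (hk : k ∈ Finset.Icc 1 i) {f : ℝ → ℝ} (h0 : ∀ u, 0 ≤ f u) {M : ℝ}
    (hM : ∀ u, f u ≤ M) {K : ℝ} (hK : ∀ u v, |f u - f v| ≤ K * |u - v|) :
    BLip i (fun x => f (x k)) := by
  have hK0 : 0 ≤ K := by simpa using (abs_nonneg _).trans (hK 1 0)
  refine ⟨fun x => h0 _, ⟨M, fun x => hM _⟩, K, hK0, fun x y => (hK _ _).trans ?_⟩
  gcongr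
  exact Finset.single_le_sum (f := fun j => |x j - y j|) (fun j _ => abs_nonneg _) hk

/-- The Lipschitz bound sees only the coordinates `1, …, i`. Hence functions of whole sequences can
replace functions on `Fin i → ℝ`, and the number of variables may grow without change of type. -/
theorem congr (hA : BLip i A) {x y : ℕ → ℝ} (h : ∀ j ∈ Finset.Icc 1 i, x j = y j) : A x = A y := by
  obtain ⟨L, hL, h1⟩ := hA.lip
  have := h1 x y
  rw [Finset.sum_eq_zero fun j hj => by rw [h j hj, sub_self, abs_zero], mul_zero] at this
  exact sub_eq_zero.mp (abs_nonpos_iff.mp this)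

end BLip

/-- A vector indexed by `Fin i`, regarded as the coordinates `1, …, i` of a sequence. -/
def extendSeq {i : ℕ} (x : Fin i → ℝ) (j : ℕ) : ℝ :=
  if h : j - 1 < i then x ⟨j - 1, h⟩ else 0

theorem abs_extendSeq_sub_le {i : ℕ} (x y : Fin i → ℝ) (j : ℕ) :
    |extendSeq x j - extendSeq y j| ≤ ‖x - y‖ := by
  unfold extendSeq
  split_ifs with h
  · exact norm_le_pi_norm (x - y) ⟨j - 1, h⟩
  · simp

theorem extendSeq_apply (x : ℕ → ℝ) {i j : ℕ} (hj : j ∈ Finset.Icc 1 i) :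
    extendSeq (fun k : Fin i => x (k + 1)) j = x j := by
  rw [Finset.mem_Icc] at hj
  have h : j - 1 < i := by omega
  simp only [extendSeq, h, dite_true]
  congr 1
  omega

theorem BLip.abs_extendSeq_sub_le {i : ℕ} {A : (ℕ → ℝ) → ℝ} (hA : BLip i A) :
    ∃ L, 0 ≤ L ∧ ∀ x y : Fin i → ℝ, |A (extendSeq x) - A (extendSeq y)| ≤ L * ‖x - y‖ := by
  obtain ⟨L, hL, h⟩ := hA.lip
  refine ⟨L * i, by positivity, fun x y => (h _ _).trans ?_⟩
  rw [mul_assoc]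
  gcongr
  refine (Finset.sum_le_sum fun j _ => SublinearExpectation.abs_extendSeq_sub_le x y j).trans ?_
  simp

variable {Ω : Type*} [MeasurableSpace Ω] {𝓔 : SublinearExpectation Ω} {X : ℕ → Ω → ℝ}

theorem BLip.integ {i : ℕ} {A : (ℕ → ℝ) → ℝ} (hA : BLip i A) (hX : ∀ n, 1 ≤ n → X n ∈ 𝓔.H) :
    𝓔.Integ (fun ω => A (fun j => X j ω)) := by
  obtain ⟨L, hL, h⟩ := hA.abs_extendSeq_sub_le
  obtain ⟨M, hM⟩ := hA.bdd
  refine Integ.of_bdd ?_ M fun ω => by rw [abs_of_nonneg (hA.nonneg _)]; exact hM _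
  have := 𝓔.comp_mem i (fun k => X (k + 1)) (fun x => A (extendSeq x))
    (fun k => hX _ (by omega)) (locLip_of_lipschitz h)
  convert this using 2 with ω
  exact hA.congr fun j hj => (extendSeq_apply (fun j => X j ω) hj).symm

/-- One step of the supermartingale argument. -/
theorem ex_add_mul_le (hX : ∀ n, 1 ≤ n → X n ∈ 𝓔.H) (hindep : 𝓔.IndepSeq X) {i : ℕ}
    {A B : (ℕ → ℝ) → ℝ} (hA : BLip i A) (hB : BLip i B) {G : ℝ → ℝ} (h0 : ∀ u, 0 ≤ G u) {M : ℝ}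
    (hM : ∀ u, G u ≤ M) {K : ℝ} (hK : ∀ u v, |G u - G v| ≤ K * |u - v|)
    (hG : 𝓔.ex (fun ω => G (X (i + 1) ω)) ≤ 1) :
    𝓔.ex (fun ω => A (fun j => X j ω) + B (fun j => X j ω) * G (X (i + 1) ω)) ≤
      𝓔.ex (fun ω => A (fun j => X j ω) + B (fun j => X j ω)) := by
  have hGX : 𝓔.Integ (fun ω => G (X (i + 1) ω)) :=
    Integ.of_bdd (comp_lipschitz_mem (hX _ (by omega)) hK) M
      fun ω => by rw [abs_of_nonneg (h0 _)]; exact hM _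
  set g := 𝓔.ex (fun ω => G (X (i + 1) ω)) with hg
  have hg0 : 0 ≤ g := ex_nonneg hGX fun ω => h0 _
  have hAB : BLip i (fun x => A x + B x * g) := hA.add (hB.mul (BLip.const hg0))
  have hABG : BLip (i + 1) (fun x => A x + B x * G (x (i + 1))) :=
    (hA.mono (by omega)).add ((hB.mono (by omega)).mul
      (BLip.coord (by simp) h0 hM hK))
  have hinner : ∀ a b : ℝ, 0 ≤ b → 𝓔.ex (fun ω => a + b * G (X (i + 1) ω)) = a + b * g := by
    intro a b hb
    simp_rw [add_comm a]
    rw [ex_add_const (hGX.const_mul b), ex_const_mul hGX hb]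
  have hfin : 𝓔.ex (fun ω => A (fun j => X j ω) + B (fun j => X j ω) * G (X (i + 1) ω)) =
      𝓔.ex (fun ω => A (fun j => X j ω) + B (fun j => X j ω) * g) := by
    -- Independence is assumed only for `i ≥ 1`; for `i = 0` both `A` and `B` are constants.
    rcases Nat.eq_zero_or_pos i with rfl | hi
    · have hA0 : ∀ x, A x = A 0 := fun x => hA.congr (by simp)
      have hB0 : ∀ x, B x = B 0 := fun x => hB.congr (by simp)
      simp only [hA0 (fun j => X j _), hB0 (fun j => X j _)]
      rw [hinner _ _ (hB.nonneg _), ex_const]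
    set φ : (Fin i → ℝ) × (Fin 1 → ℝ) → ℝ :=
      fun z => A (extendSeq z.1) + B (extendSeq z.1) * G (z.2 0) with hφ
    have hφ0 : ∀ z, 0 ≤ φ z := fun z =>
      add_nonneg (hA.nonneg _) (mul_nonneg (hB.nonneg _) (h0 _))
    have hφX : ∀ ω y, φ (fun k : Fin i => X (k + 1) ω, y) =
        A (fun j => X j ω) + B (fun j => X j ω) * G (y 0) := by
      intro ω y
      simp only [hφ]
      rw [hA.congr fun j hj => extendSeq_apply (fun j => X j ω) hj,
        hB.congr fun j hj => extendSeq_apply (fun j => X j ω) hj]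
    have hφL : LocLip φ := by
      obtain ⟨L, hL, hLA⟩ := hA.abs_extendSeq_sub_le
      obtain ⟨L', hL', hLB⟩ := hB.abs_extendSeq_sub_le
      obtain ⟨N, hN⟩ := hB.bdd
      have hN0 : 0 ≤ N := (hB.nonneg 0).trans (hN 0)
      have hM0 : 0 ≤ M := (h0 0).trans (hM 0)
      have hK0 : 0 ≤ K := by simpa using (abs_nonneg _).trans (hK 1 0)
      refine locLip_of_lipschitz (L := L + N * K + L' * M) fun z w => ?_
      have h1 : ‖z.1 - w.1‖ ≤ ‖z - w‖ := norm_fst_le (z - w)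
      have h2 : |z.2 0 - w.2 0| ≤ ‖z - w‖ :=
        (norm_le_pi_norm (z.2 - w.2) 0).trans (norm_snd_le (z - w))
      have h3 : φ z - φ w = (A (extendSeq z.1) - A (extendSeq w.1)) +
          B (extendSeq z.1) * (G (z.2 0) - G (w.2 0)) +
          (B (extendSeq z.1) - B (extendSeq w.1)) * G (w.2 0) := by simp only [hφ]; ring
      rw [h3, add_mul, add_mul, mul_assoc, mul_right_comm]
      refine (abs_add_three _ _ _).trans ?_
      rw [abs_mul, abs_mul, abs_of_nonneg (hB.nonneg (extendSeq z.1)), abs_of_nonneg (h0 (w.2 0))]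
      refine add_le_add (add_le_add ((hLA _ _).trans ?_) ?_) ?_
      · gcongr
      · exact mul_le_mul (hN _) ((hK _ _).trans (by gcongr)) (abs_nonneg _) hN0
      · exact mul_le_mul ((hLB _ _).trans (by gcongr)) (hM _) (h0 _) (by positivity)
    -- Since `φ ≥ 0`, the inner expectations of `φ` and `|φ|` are both `A + B g`, so `hAB` settles
    -- all the side conditions on functions of the past.
    have key := hindep i hi φ hφL
    simp only [abs_of_nonneg (hφ0 _)] at key
    simp only [hφX, hinner _ _ (hB.nonneg _)] at key
    have hmem := (hAB.integ hX)
    unfold ex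
    rw [key ?_ hmem.mem hmem.mem hmem.lt_top]
    intro x
    exact ((Integ.const (A (extendSeq x))).add (hGX.const_mul (B (extendSeq x)))).E_lt_top
  rw [hfin]
  refine ex_mono (hAB.integ hX) ((hA.add hB).integ hX) fun ω => ?_
  have := mul_le_mul_of_nonneg_left hG (hB.nonneg (fun j => X j ω))
  linarith

section Maximal

variable (G : ℕ → ℝ → ℝ) (c : ℝ)

/-- The product process `U_k = ∏_{j ≤ k} G_j(x_j)`. -/
def runProd (k : ℕ) (x : ℕ → ℝ) : ℝ := ∏ j ∈ Finset.Icc 1 k, G j (x j)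

/-- The (smoothed) indicator that the product process has not reached the level `c` up to `k`. -/
noncomputable def notYet (k : ℕ) (x : ℕ → ℝ) : ℝ :=
  ∏ j ∈ Finset.Icc 1 k, (1 - ramp c (runProd G j x))

/-- The (smoothed) value of the product process at the first passage of the level `c` up to `k`. -/
noncomputable def passage : ℕ → (ℕ → ℝ) → ℝ
  | 0, _ => 0
  | k + 1, x => passage k x +
      notYet G c k x * (ramp c (runProd G (k + 1) x) * runProd G (k + 1) x)

variable {G c}

theorem runProd_succ (k : ℕ) (x : ℕ → ℝ) :
    runProd G (k + 1) x = runProd G k x * G (k + 1) (x (k + 1)) :=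
  Finset.prod_Icc_succ_top (by omega) _

theorem notYet_succ (k : ℕ) (x : ℕ → ℝ) :
    notYet G c (k + 1) x = notYet G c k x * (1 - ramp c (runProd G (k + 1) x)) :=
  Finset.prod_Icc_succ_top (by omega) _

theorem notYet_nonneg (k : ℕ) (x : ℕ → ℝ) : 0 ≤ notYet G c k x :=
  Finset.prod_nonneg fun _ _ => sub_nonneg.mpr (ramp_le_one _ _)

/-- Each step removes the mass `notYet * ramp` from `notYet`. The ramp vanishes where the product is
at most `c / 2`, so this mass enters `passage` with weight at least `c / 2`. -/
theorem le_passage (hc : 0 < c) (k : ℕ) (x : ℕ → ℝ) :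
    c / 2 * (1 - notYet G c k x) ≤ passage G c k x := by
  induction k with
  | zero => simp [notYet, passage]
  | succ k ih =>
    rw [notYet_succ, passage]
    have h1 : c / 2 * ramp c (runProd G (k + 1) x) ≤
        ramp c (runProd G (k + 1) x) * runProd G (k + 1) x := by
      rw [mul_comm]
      rcases le_total (runProd G (k + 1) x) (c / 2) with h | h
      · rw [ramp_of_le_half hc h]; simp
      · exact mul_le_mul_of_nonneg_left h (ramp_nonneg _ _)
    have := mul_le_mul_of_nonneg_left h1 (notYet_nonneg (G := G) (c := c) k x)
    linarith

variable (hc : 0 < c) (h0 : ∀ j u, 0 ≤ G j u) {M : ℕ → ℝ} (hM : ∀ j u, G j u ≤ M j) {K : ℕ → ℝ}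
  (hK : ∀ j u v, |G j u - G j v| ≤ K j * |u - v|)
include h0 hM hK

theorem blip_runProd (k : ℕ) : BLip k (runProd G k) := by
  induction k with
  | zero => exact BLip.const zero_le_one
  | succ k ih =>
    simp only [funext (runProd_succ (G := G) k)]
    exact (ih.mono (by omega)).mul (BLip.coord (by simp) (h0 _) (hM _) (hK _))

include hc

theorem blip_ramp (k : ℕ) : BLip k (fun x => ramp c (runProd G k x)) :=
  (blip_runProd h0 hM hK k).comp (ramp_nonneg c) (ramp_le_one c) (abs_ramp_sub_le hc)

theorem blip_notYet (k : ℕ) : BLip k (notYet G c k) := by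
  induction k with
  | zero => exact BLip.const zero_le_one
  | succ k ih =>
    simp only [funext (notYet_succ (G := G) (c := c) k)]
    refine (ih.mono (by omega)).mul ((blip_runProd h0 hM hK (k + 1)).comp
      (f := fun u => 1 - ramp c u) (M := 1) (K := 2 / c) (fun u => ?_) (fun u => ?_) fun u v => ?_)
    · linarith [ramp_le_one c u]
    · linarith [ramp_nonneg c u]
    · rw [sub_sub_sub_cancel_left, abs_sub_comm]
      exact abs_ramp_sub_le hc u v

theorem blip_passage (k : ℕ) : BLip k (passage G c k) := by
  induction k with
  | zero => exact BLip.const le_rfl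
  | succ k ih =>
    exact (ih.mono (by omega)).add (((blip_notYet hc h0 hM hK k).mono (by omega)).mul
      ((blip_ramp hc h0 hM hK (k + 1)).mul (blip_runProd h0 hM hK (k + 1))))

/-- The expression is the smoothly stopped product process. In passing from `k` to `k + 1` the ramp
terms cancel, leaving `passage_k + notYet_k * U_k * G_{k+1}`, to which the one-step inequality
applies. -/
theorem ex_passage_add_le (hX : ∀ n, 1 ≤ n → X n ∈ 𝓔.H) (hindep : 𝓔.IndepSeq X)
    (hG : ∀ j, 1 ≤ j → 𝓔.ex (fun ω => G j (X j ω)) ≤ 1) (k : ℕ) :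
    𝓔.ex (fun ω => passage G c k (fun j => X j ω) +
      notYet G c k (fun j => X j ω) * runProd G k (fun j => X j ω)) ≤ 1 := by
  induction k with
  | zero => simp [passage, notYet, runProd, ex_const]
  | succ k ih =>
    refine le_trans (le_of_eq ?_) ((ex_add_mul_le hX hindep (blip_passage hc h0 hM hK k)
      ((blip_notYet hc h0 hM hK k).mul (blip_runProd h0 hM hK k)) (h0 _) (hM _) (hK _)
      (hG (k + 1) (by omega))).trans ih)
    congr 1
    ext ω
    rw [passage, notYet_succ, runProd_succ]
    ring

/-- A maximal inequality for products of independent factors of upper expectation at most one. -/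
theorem upperCap_exists_runProd_le (hX : ∀ n, 1 ≤ n → X n ∈ 𝓔.H) (hindep : 𝓔.IndepSeq X)
    (hG : ∀ j, 1 ≤ j → 𝓔.ex (fun ω => G j (X j ω)) ≤ 1) (n : ℕ) :
    𝓔.upperCap {ω | ∃ k ∈ Finset.Icc 1 n, c ≤ runProd G k (fun j => X j ω)} ≤
      ENNReal.ofReal (2 / c) := by
  have hA := (blip_passage hc h0 hM hK n).integ hX
  have hmono : 𝓔.ex (fun ω => passage G c n (fun j => X j ω)) ≤ 1 := by
    refine le_trans ?_ (ex_passage_add_le hc h0 hM hK hX hindep hG n)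
    refine ex_mono hA (((blip_passage hc h0 hM hK n).add
      ((blip_notYet hc h0 hM hK n).mul (blip_runProd h0 hM hK n))).integ hX) fun ω => ?_
    have := mul_nonneg ((blip_notYet hc h0 hM hK n).nonneg (fun j => X j ω))
      ((blip_runProd h0 hM hK n).nonneg (fun j => X j ω))
    linarith
  refine (upperCap_le_div hA (half_pos hc) ?_ fun ω => (blip_passage hc h0 hM hK n).nonneg _).trans
    (ENNReal.ofReal_le_ofReal ?_)
  · rintro ω ⟨k, hk, hck⟩
    have h1 : notYet G c n (fun j => X j ω) = 0 :=
      Finset.prod_eq_zero hk (by rw [ramp_of_le hc hck, sub_self])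
    have := le_passage (G := G) hc n (fun j => X j ω)
    rwa [h1, sub_zero, mul_one] at this
  · rw [div_le_div_iff₀ (half_pos hc) hc]
    nlinarith

end Maximal

end SublinearExpectation

/-! ### Two real inequalities. -/

/-- For `u ≤ 0`, invert the quadratic lower bound for `exp (-u)`. For `u ≥ 0`, the function `(1 + v)
exp (-v) + v^2 / 2` is nondecreasing and equals 1 at 0; multiply by `exp u`. -/
theorem Real.exp_le_quadratic {u α : ℝ} (hα : 0 ≤ α) (h : u ≤ α) :
    Real.exp u ≤ 1 + u + u ^ 2 / 2 * Real.exp α := by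
  rcases le_total u 0 with hu | hu
  · have h1 := Real.quadratic_le_exp_of_nonneg (x := -u) (by linarith)
    have h2 : Real.exp u * Real.exp (-u) = 1 := by rw [← Real.exp_add]; simp
    have h3 : 1 ≤ Real.exp α := Real.one_le_exp hα
    have h4 : Real.exp u * (1 + -u + (-u) ^ 2 / 2) ≤ 1 :=
      (mul_le_mul_of_nonneg_left h1 (Real.exp_pos u).le).trans_eq h2
    have h6 : 0 < 1 + -u + (-u) ^ 2 / 2 := by nlinarith
    have h5 : Real.exp u ≤ 1 + u + u ^ 2 / 2 := by
      rw [← le_div_iff₀ h6] at h4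
      refine h4.trans ?_
      rw [div_le_iff₀ h6]
      nlinarith [sq_nonneg (u ^ 2)]
    nlinarith [sq_nonneg u]
  · have hmono : Monotone (fun v : ℝ => (1 + v) * Real.exp (-v) + v ^ 2 / 2) := by
      have hd : ∀ v : ℝ, HasDerivAt (fun v : ℝ => (1 + v) * Real.exp (-v) + v ^ 2 / 2)
          (v * (1 - Real.exp (-v))) v := by
        intro v
        have h1 := ((hasDerivAt_id v).const_add 1).mul (hasDerivAt_neg v).exp
        have h2 := ((hasDerivAt_id v).pow 2).div_const 2
        refine (h1.add h2).congr_deriv ?_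
        simp only [id_eq, Nat.cast_ofNat, Nat.add_one_sub_one, pow_one]
        ring
      refine monotone_of_deriv_nonneg (fun v => (hd v).differentiableAt) fun v => ?_
      rw [(hd v).deriv]
      rcases le_total v 0 with hv | hv
      · have := Real.one_le_exp (x := -v) (by linarith)
        exact mul_nonneg_of_nonpos_of_nonpos hv (by linarith)
      · have := Real.exp_le_one_iff.mpr (neg_nonpos.mpr hv)
        exact mul_nonneg hv (by linarith)
    have h1 := hmono hu
    simp only [add_zero, neg_zero, Real.exp_zero, mul_one, ne_eq, OfNat.ofNat_ne_zero,
      not_false_eq_true, zero_pow, zero_div] at h1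
    have h2 : Real.exp u * Real.exp (-u) = 1 := by rw [← Real.exp_add]; simp
    have h3 := Real.exp_le_exp.mpr h
    have h4 := mul_le_mul_of_nonneg_left h1 (Real.exp_pos u).le
    have h5 : u ^ 2 / 2 * Real.exp u ≤ u ^ 2 / 2 * Real.exp α := by gcongr
    nlinarith

/-- Bernoulli's inequality for `x / y = 1 + (x - y) / y`. -/
theorem Real.rpow_sub_rpow_le {x y q : ℝ} (hx : 0 ≤ x) (hxy : x ≤ y) (hq : 1 ≤ q) :
    y ^ q - x ^ q ≤ q * y ^ (q - 1) * (y - x) := by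
  rcases hx.eq_or_lt with rfl | hx'
  · rcases hxy.eq_or_lt with rfl | hy
    · simp
    · rw [Real.zero_rpow (by linarith), sub_zero, sub_zero, mul_assoc, ← Real.rpow_add_one hy.ne',
        sub_add_cancel]
      nlinarith [Real.rpow_nonneg hy.le q]
  · have hy : 0 < y := hx'.trans_le hxy
    have h := one_add_mul_self_le_rpow_one_add (s := (x - y) / y)
      (by rw [le_div_iff₀ hy]; linarith) hq
    have h1 : 1 + (x - y) / y = x / y := by field_simp; ring
    rw [h1, Real.div_rpow hx hy.le, le_div_iff₀ (Real.rpow_pos_of_pos hy q)] at h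
    have h2 : y ^ q = y ^ (q - 1) * y := by rw [← Real.rpow_add_one hy.ne', sub_add_cancel]
    have h3 : (1 + q * ((x - y) / y)) * y ^ q = y ^ q - q * y ^ (q - 1) * (y - x) := by
      rw [h2]; field_simp; ring
    linarith

/-! ### Truncated variables, exponential moments and expectations of partial sums. -/

namespace SublinearExpectation

/-- The truncated excess `((|u| ∧ a - c)⁺)^p`. -/
noncomputable def excessPow (p a c u : ℝ) : ℝ := (max (min |u| a - c) 0) ^ p

theorem excessPow_nonneg (p a c u : ℝ) : 0 ≤ excessPow p a c u :=
  Real.rpow_nonneg (le_max_right _ _) p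

theorem excess_le {a c : ℝ} (ha : 0 ≤ a) (hc : 0 ≤ c) (u : ℝ) : max (min |u| a - c) 0 ≤ a :=
  max_le (by linarith [min_le_right |u| a]) ha

theorem excessPow_le {p a c : ℝ} (hp : 0 ≤ p) (ha : 0 ≤ a) (hc : 0 ≤ c) (u : ℝ) :
    excessPow p a c u ≤ a ^ p :=
  Real.rpow_le_rpow (le_max_right _ _) (excess_le ha hc u) hp

theorem excessPow_mono {p a a' c c' : ℝ} (hp : 0 ≤ p) (ha : a ≤ a') (hc : c' ≤ c) (u : ℝ) :
    excessPow p a c u ≤ excessPow p a' c' u := by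
  unfold excessPow
  gcongr

theorem abs_excessPow_sub_le {p a c : ℝ} (hp : 1 ≤ p) (ha : 0 ≤ a) (hc : 0 ≤ c) (u v : ℝ) :
    |excessPow p a c u - excessPow p a c v| ≤ p * a ^ (p - 1) * |u - v| := by
  have key : ∀ x y : ℝ, 0 ≤ x → 0 ≤ y → x ≤ a → y ≤ a →
      |x ^ p - y ^ p| ≤ p * a ^ (p - 1) * |x - y| := by
    intro x y hx hy hxa hya
    wlog h : y ≤ x generalizing x y
    · rw [abs_sub_comm, abs_sub_comm x]
      exact this y x hy hx hya hxa (le_of_not_ge h)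
    rw [abs_of_nonneg (sub_nonneg.mpr h),
      abs_of_nonneg (sub_nonneg.mpr (Real.rpow_le_rpow hy h (by linarith)))]
    refine (Real.rpow_sub_rpow_le hy h hp).trans ?_
    have : x ^ (p - 1) ≤ a ^ (p - 1) := Real.rpow_le_rpow hx hxa (by linarith)
    have : 0 ≤ x - y := by linarith
    gcongr
  refine (key _ _ (le_max_right _ _) (le_max_right _ _) (excess_le ha hc u)
    (excess_le ha hc v)).trans ?_
  have h0 : 0 ≤ a ^ (p - 1) := Real.rpow_nonneg ha _
  have h1 := abs_max_sub_max_le_max (min |u| a - c) 0 (min |v| a - c) 0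
  have h2 := abs_min_sub_min_le_max (|u|) a (|v|) a
  simp only [sub_self, abs_zero, abs_nonneg, sup_of_le_left, sub_sub_sub_cancel_right] at h1 h2
  exact mul_le_mul_of_nonneg_left (h1.trans (h2.trans (abs_abs_sub_abs_le_abs_sub u v)))
    (by positivity)

theorem partialSum_succ {Ω : Type*} {X : ℕ → Ω → ℝ} (n : ℕ) (ω : Ω) :
    partialSum X (n + 1) ω = partialSum X n ω + X (n + 1) ω :=
  Finset.sum_Icc_succ_top (by omega) _

theorem partialSum_eq_sum_fin {Ω : Type*} {X : ℕ → Ω → ℝ} (n : ℕ) (ω : Ω) :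
    partialSum X n ω = ∑ j : Fin n, X (j + 1) ω := by
  induction n with
  | zero => simp [partialSum]
  | succ n ih => rw [partialSum_succ, ih, Fin.sum_univ_castSucc]; simp

/-- Below the level `b = α / l` the exponent is at most `α` and the quadratic bound applies. Above
it, the excess over `b₀ / 2` is at least `b / 2`, so `(2 / b)^p * excessPow ≥ 1` and the crude bound
`exp (l y)` suffices. The separate level `b₀ ≤ b` keeps the moment term independent of the rate `l`.
-/
theorem exp_min_le {l α b b₀ y a p x : ℝ} (hl : 0 < l) (hα : 0 ≤ α) (hb : l * b = α) (hy : 0 ≤ y)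
    (hya : y ≤ a) (hb₀ : 0 < b₀) (hbb : b₀ ≤ b) (hp : 0 ≤ p) :
    Real.exp (l * min x y) ≤ 1 + (l * x + (l ^ 2 / 2 * Real.exp α * x ^ 2 +
      Real.exp (l * y) * (2 / b) ^ p * excessPow p a (b₀ / 2) x)) := by
  have hb0 : 0 < b := hb₀.trans_le hbb
  have hZ : 0 ≤ Real.exp (l * y) * (2 / b) ^ p * excessPow p a (b₀ / 2) x :=
    mul_nonneg (by positivity) (excessPow_nonneg _ _ _ _)
  rcases le_total (min x y) b with h | h
  · have h1 := Real.exp_le_quadratic (u := l * min x y) hα (by rw [← hb]; gcongr)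
    have h2 : l * min x y ≤ l * x := by gcongr; exact min_le_left _ _
    have h3 : (min x y) ^ 2 ≤ x ^ 2 := by
      rcases le_total x y with hxy | hxy
      · rw [min_eq_left hxy]
      · rw [min_eq_right hxy]; gcongr
    have h4 : (l * min x y) ^ 2 / 2 * Real.exp α ≤ l ^ 2 / 2 * Real.exp α * x ^ 2 := by
      have : (l * min x y) ^ 2 / 2 * Real.exp α = l ^ 2 / 2 * Real.exp α * (min x y) ^ 2 := by ring
      rw [this]; gcongr
    linarith
  · have hbx : b ≤ x := h.trans (min_le_left _ _)
    have hby : b ≤ y := h.trans (min_le_right _ _)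
    have h1 : Real.exp (l * min x y) ≤ Real.exp (l * y) := by
      gcongr; exact min_le_right _ _
    have h2 : 1 ≤ (2 / b) ^ p * excessPow p a (b₀ / 2) x := by
      unfold excessPow
      rw [← Real.mul_rpow (by positivity) (le_max_right _ _)]
      refine Real.one_le_rpow ?_ hp
      have h3 : b / 2 ≤ max (min |x| a - b₀ / 2) 0 := by
        refine le_max_of_le_left ?_
        have : b ≤ min |x| a := le_min (hbx.trans (le_abs_self x)) (hby.trans hya)
        linarith
      calc (1 : ℝ) = 2 / b * (b / 2) := by field_simp
        _ ≤ _ := by gcongr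
    have h3 := mul_le_mul_of_nonneg_left h2 (Real.exp_pos (l * y)).le
    have h4 : 0 ≤ l * x := mul_nonneg hl.le (hb0.le.trans hbx)
    have h5 : 0 ≤ l ^ 2 / 2 * Real.exp α * x ^ 2 := by positivity
    linarith

variable {Ω : Type*} [MeasurableSpace Ω] {𝓔 : SublinearExpectation Ω}

theorem integ_excessPow {X : Ω → ℝ} (hX : X ∈ 𝓔.H) {p a c : ℝ} (hp : 1 ≤ p) (ha : 0 ≤ a)
    (hc : 0 ≤ c) : 𝓔.Integ (fun ω => excessPow p a c (X ω)) :=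
  Integ.of_bdd (comp_lipschitz_mem hX (abs_excessPow_sub_le hp ha hc)) (a ^ p) fun ω => by
    rw [abs_of_nonneg (excessPow_nonneg _ _ _ _)]
    exact excessPow_le (by linarith) ha hc _

theorem abs_exp_min_sub_le {l y : ℝ} (hl : 0 ≤ l) (u v : ℝ) :
    |Real.exp (l * min u y) - Real.exp (l * min v y)| ≤ l * Real.exp (l * y) * |u - v| := by
  wlog h : v ≤ u generalizing u v
  · rw [abs_sub_comm, abs_sub_comm u]
    exact this v u (le_of_not_ge h)
  have h1 : min v y ≤ min u y := min_le_min_right _ h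
  rw [abs_of_nonneg (sub_nonneg.mpr h),
    abs_of_nonneg (sub_nonneg.mpr (Real.exp_le_exp.mpr (by gcongr)))]
  have h2 := Real.add_one_le_exp (l * min v y - l * min u y)
  have h3 : Real.exp (l * min v y) =
      Real.exp (l * min u y) * Real.exp (l * min v y - l * min u y) := by
    rw [← Real.exp_add]; ring_nf
  have h4 := mul_le_mul_of_nonneg_left h2 (Real.exp_pos (l * min u y)).le
  have h5 : min u y - min v y ≤ u - v := by
    have := abs_min_sub_min_le_max u y v y
    simp only [sub_self, abs_zero, abs_nonneg, sup_of_le_left] at this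
    exact (le_abs_self _).trans (this.trans (abs_of_nonneg (sub_nonneg.mpr h)).le)
  calc _ ≤ Real.exp (l * min u y) * (l * (min u y - min v y)) := by rw [h3]; linarith
    _ ≤ Real.exp (l * y) * (l * (u - v)) := by
      have : 0 ≤ min u y - min v y := by linarith
      gcongr
      exact min_le_right _ _
    _ = _ := by ring

theorem ex_exp_min_le {X : Ω → ℝ} (hX : 𝓔.Integ X) (hX2 : 𝓔.Integ (fun ω => X ω ^ 2))
    {l α b b₀ y a p : ℝ} (hl : 0 < l) (hα : 0 ≤ α) (hb : l * b = α) (hy : 0 ≤ y)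
    (hya : y ≤ a) (hb₀ : 0 < b₀) (hbb : b₀ ≤ b) (hp : 1 ≤ p) :
    𝓔.ex (fun ω => Real.exp (l * min (X ω) y)) ≤ Real.exp (l * 𝓔.ex X +
      (l ^ 2 / 2 * Real.exp α * 𝓔.ex (fun ω => X ω ^ 2) + Real.exp (l * y) * (2 / b) ^ p *
        𝓔.ex (fun ω => excessPow p a (b₀ / 2) (X ω)))) := by
  have hb0 : 0 < b := hb₀.trans_le hbb
  have hZ := integ_excessPow hX.mem hp (hy.trans hya) (half_pos hb₀).le
  have h0 : 𝓔.Integ (fun ω => Real.exp (l * min (X ω) y)) := by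
    refine Integ.of_bdd (comp_lipschitz_mem (f := fun u => Real.exp (l * min u y)) hX.mem
      (abs_exp_min_sub_le hl.le)) (Real.exp (l * y)) fun ω => ?_
    rw [abs_of_pos (Real.exp_pos _)]
    gcongr
    exact min_le_right _ _
  have h1 := hX.const_mul l
  have h2 := hX2.const_mul (l ^ 2 / 2 * Real.exp α)
  have h3 := hZ.const_mul (Real.exp (l * y) * (2 / b) ^ p)
  calc _ ≤ 𝓔.ex (fun ω => 1 + (l * X ω + (l ^ 2 / 2 * Real.exp α * X ω ^ 2 +
      Real.exp (l * y) * (2 / b) ^ p * excessPow p a (b₀ / 2) (X ω)))) :=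
        ex_mono h0 ((Integ.const 1).add (h1.add (h2.add h3)))
          fun ω => exp_min_le hl hα hb hy hya hb₀ hbb (by linarith)
    _ ≤ 1 + (l * 𝓔.ex X + (l ^ 2 / 2 * Real.exp α * 𝓔.ex (fun ω => X ω ^ 2) +
      Real.exp (l * y) * (2 / b) ^ p * 𝓔.ex (fun ω => excessPow p a (b₀ / 2) (X ω)))) := by
        rw [← ex_const_mul hX hl.le, ← ex_const_mul hX2 (by positivity),
          ← ex_const_mul hZ (by positivity)]
        refine (ex_add_le (Integ.const 1) (h1.add (h2.add h3))).trans ?_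
        rw [ex_const]
        gcongr
        refine (ex_add_le h1 (h2.add h3)).trans ?_
        gcongr
        exact ex_add_le h2 h3
    _ ≤ _ := by rw [add_comm]; exact Real.add_one_le_exp _

variable {X : ℕ → Ω → ℝ}

theorem integ_partialSum (hX : ∀ n, 1 ≤ n → 𝓔.Integ (X n)) (n : ℕ) : 𝓔.Integ (partialSum X n) :=
  Integ.sum fun i hi => hX i (Finset.mem_Icc.mp hi).1

/-- Independence is tested on `(x, y) ↦ ∑ x_j + y`: by translation the inner expectation is `∑ x_j +
E[X_{n+1}]`, so sub-additivity becomes equality. -/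
theorem ex_partialSum_succ (hX : ∀ n, 1 ≤ n → 𝓔.Integ (X n)) (hindep : 𝓔.IndepSeq X) {n : ℕ}
    (hn : 1 ≤ n) : 𝓔.ex (partialSum X (n + 1)) = 𝓔.ex (partialSum X n) + 𝓔.ex (X (n + 1)) := by
  have hY := hX (n + 1) (by omega)
  have hS := integ_partialSum hX n
  set φ : (Fin n → ℝ) × (Fin 1 → ℝ) → ℝ := fun z => ∑ j, z.1 j + z.2 0 with hφ
  have hφX : ∀ ω y, φ (fun k : Fin n => X (k + 1) ω, y) = partialSum X n ω + y 0 := by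
    intro ω y
    simp only [hφ, partialSum_eq_sum_fin]
  have hφL : LocLip φ := by
    refine locLip_of_lipschitz (L := n + 1) fun z w => ?_
    have h1 : ‖z.1 - w.1‖ ≤ ‖z - w‖ := norm_fst_le (z - w)
    have h2 : |z.2 0 - w.2 0| ≤ ‖z - w‖ :=
      (norm_le_pi_norm (z.2 - w.2) 0).trans (norm_snd_le (z - w))
    have h3 : φ z - φ w = ∑ j, (z.1 j - w.1 j) + (z.2 0 - w.2 0) := by
      simp only [hφ, Finset.sum_sub_distrib]; ring
    rw [h3, add_mul, one_mul]
    refine (abs_add_le _ _).trans (add_le_add ((Finset.abs_sum_le_sum_abs _ _).trans ?_) h2)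
    refine (Finset.sum_le_sum fun j _ => (norm_le_pi_norm (z.1 - w.1) j).trans h1).trans ?_
    simp
  have key := hindep n hn φ hφL
  simp only [hφX] at key
  have hshift : ∀ s : ℝ, 𝓔.Integ (fun ω => s + X (n + 1) ω) := fun s => (Integ.const s).add hY
  -- The map `s ↦ E|s + X_{n+1}|` is 1-Lipschitz and at most `|s| + E|X_{n+1}|`, which gives both
  -- membership in `H` and finiteness.
  have hmem : 𝓔.Integ (fun ω => 𝓔.ex (fun ω' => |partialSum X n ω + X (n + 1) ω'|)) := by
    refine (hS.abs.add (Integ.const (𝓔.ex fun ω' => |X (n + 1) ω'|))).of_le ?_ fun ω => ?_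
    · refine comp_lipschitz_mem (f := fun s => 𝓔.ex (fun ω' => |s + X (n + 1) ω'|)) (L := 1)
        hS.mem fun s s' => ?_
      refine (ex_abs_sub_le (hshift s).abs (hshift s').abs).trans ?_
      rw [one_mul, ← ex_const (𝓔 := 𝓔) |s - s'|]
      refine ex_mono ((hshift s).abs.sub (hshift s').abs).abs (Integ.const _) fun ω => ?_
      refine (abs_abs_sub_abs_le_abs_sub _ _).trans ?_
      rw [add_sub_add_right_eq_sub]
    · rw [abs_of_nonneg (ex_nonneg (hshift _).abs fun _ => abs_nonneg _), add_comm |_|,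
        ← ex_add_const hY.abs]
      refine ex_mono (hshift _).abs (hY.abs.add (Integ.const _)) fun ω' => ?_
      rw [add_comm |X _ _|]
      exact abs_add_le _ _
  have hin : ∀ s : ℝ, 𝓔.ex (fun ω => s + X (n + 1) ω) = s + 𝓔.ex (X (n + 1)) := by
    intro s
    simp only [add_comm s]
    exact ex_add_const hY s
  simp only [hin] at key
  have h1 : 𝓔.ex (partialSum X (n + 1)) =
      𝓔.ex (fun ω => partialSum X n ω + 𝓔.ex (X (n + 1))) := by
    have : partialSum X (n + 1) = fun ω => partialSum X n ω + X (n + 1) ω :=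
      funext (partialSum_succ n)
    rw [this]
    unfold ex at key ⊢
    rw [key ?_ hmem.mem (hS.add (Integ.const _)).mem hmem.lt_top]
    intro x
    exact (hshift (∑ j, x j)).lt_top
  rw [h1, ex_add_const hS]

theorem ex_partialSum (hX : ∀ n, 1 ≤ n → 𝓔.Integ (X n)) (hindep : 𝓔.IndepSeq X) (n : ℕ) :
    𝓔.ex (partialSum X n) = ∑ k ∈ Finset.Icc 1 n, 𝓔.ex (X k) := by
  induction n with
  | zero =>
    have : partialSum X 0 = fun _ => (0 : ℝ) := by ext; simp [partialSum]
    simp [this, ex_const]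
  | succ n ih =>
    rw [Finset.sum_Icc_succ_top (by omega), ← ih]
    rcases Nat.eq_zero_or_pos n with rfl | hn
    · have h0 : partialSum X 0 = fun _ => (0 : ℝ) := by ext; simp [partialSum]
      have h1 : partialSum X 1 = X 1 := by ext; simp [partialSum]
      simp [h0, h1, ex_const]
    · exact ex_partialSum_succ hX hindep hn

end SublinearExpectation

/-! ### The iterated logarithm and the normalizing sequences. -/

theorem one_le_logE (x : ℝ) : 1 ≤ logE x := by
  rw [logE, Real.le_log_iff_exp_le (lt_max_of_lt_left (Real.exp_pos 1))]
  exact le_max_left _ _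

theorem logE_mono {x y : ℝ} (h : x ≤ y) : logE x ≤ logE y :=
  Real.log_le_log (lt_max_of_lt_left (Real.exp_pos 1)) (max_le_max_left _ h)

theorem le_exp_logE (x : ℝ) : x ≤ Real.exp (logE x) := by
  rw [logE, Real.exp_log (lt_max_of_lt_left (Real.exp_pos 1))]
  exact le_max_right _ _

/-- By `log c ≤ c - 1` and `logE x ≥ 1`. The form is chosen so that it can be iterated. -/
theorem logE_mul_le {c x y : ℝ} (hc : 1 ≤ c) (h : y ≤ c * x) : logE y ≤ c * logE x := by
  have h0 : 0 < max (Real.exp 1) x := lt_max_of_lt_left (Real.exp_pos 1)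
  have h1 : max (Real.exp 1) y ≤ c * max (Real.exp 1) x := by
    refine max_le ?_ (h.trans ?_)
    · have := le_max_left (Real.exp 1) x
      nlinarith
    · have := le_max_right (Real.exp 1) x
      gcongr
  calc logE y ≤ Real.log (c * max (Real.exp 1) x) :=
        Real.log_le_log (lt_max_of_lt_left (Real.exp_pos 1)) h1
    _ = Real.log c + logE x := Real.log_mul (by positivity) h0.ne'
    _ ≤ (c - 1) + logE x := by
        have := Real.log_le_sub_one_of_pos (lt_of_lt_of_le one_pos hc)
        gcongr
    _ ≤ c * logE x := by nlinarith [one_le_logE x]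

theorem logE_logE_mul_le {c x y : ℝ} (hc : 1 ≤ c) (h : y ≤ c * x) :
    logE (logE y) ≤ c * logE (logE x) :=
  logE_mul_le hc (logE_mul_le hc h)

namespace SublinearExpectation

variable {Ω : Type*} [MeasurableSpace Ω] {𝓔 : SublinearExpectation Ω} {X : ℕ → Ω → ℝ}

theorem sSq_succ (n : ℕ) : 𝓔.sSq X (n + 1) = 𝓔.sSq X n + 𝓔.ex (fun ω => X (n + 1) ω ^ 2) :=
  Finset.sum_Icc_succ_top (by omega) _

theorem t_sq (n : ℕ) : 𝓔.t X n ^ 2 = 2 * logE (logE (𝓔.sSq X n)) :=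
  Real.sq_sqrt (by have := one_le_logE (logE (𝓔.sSq X n)); linarith)

theorem t_pos (n : ℕ) : 0 < 𝓔.t X n :=
  Real.sqrt_pos.mpr (by have := one_le_logE (logE (𝓔.sSq X n)); linarith)

theorem a_nonneg (n : ℕ) : 0 ≤ 𝓔.a X n := mul_nonneg (Real.sqrt_nonneg _) (t_pos n).le

theorem s_pos {n : ℕ} (h : 0 < 𝓔.sSq X n) : 0 < 𝓔.s X n := Real.sqrt_pos.mpr h

theorem a_pos {n : ℕ} (h : 0 < 𝓔.sSq X n) : 0 < 𝓔.a X n := mul_pos (s_pos h) (t_pos n)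

variable (hX2 : ∀ n, 1 ≤ n → 𝓔.Integ (fun ω => X n ω ^ 2))
include hX2

theorem sSq_mono : Monotone (𝓔.sSq X) := by
  refine monotone_nat_of_le_succ fun n => ?_
  rw [sSq_succ]
  have := ex_nonneg (hX2 (n + 1) (by omega)) fun ω => sq_nonneg _
  linarith

theorem sSq_nonneg (n : ℕ) : 0 ≤ 𝓔.sSq X n := by
  have := sSq_mono hX2 (Nat.zero_le n)
  simpa [sSq] using this

theorem s_sq (n : ℕ) : 𝓔.s X n ^ 2 = 𝓔.sSq X n := Real.sq_sqrt (sSq_nonneg hX2 n)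

theorem a_sq (n : ℕ) : 𝓔.a X n ^ 2 = 2 * (𝓔.sSq X n * logE (logE (𝓔.sSq X n))) := by
  rw [a, mul_pow, s_sq hX2, t_sq]; ring

theorem a_mono : Monotone (𝓔.a X) := by
  intro m n h
  have h1 := sSq_mono hX2 h
  have h2 := logE_mono (logE_mono h1)
  refine mul_le_mul (Real.sqrt_le_sqrt h1) (Real.sqrt_le_sqrt ?_) (t_pos m).le (Real.sqrt_nonneg _)
  linarith

theorem a_le_mul {m n : ℕ} {c : ℝ} (hc : 1 ≤ c) (h : 𝓔.sSq X n ≤ c * 𝓔.sSq X m) :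
    𝓔.a X n ≤ c * 𝓔.a X m := by
  refine le_of_sq_le_sq ?_ (mul_nonneg (by linarith) (a_nonneg m))
  rw [mul_pow, a_sq hX2, a_sq hX2]
  have h1 := logE_logE_mul_le hc h
  have h2 := one_le_logE (logE (𝓔.sSq X n))
  have h3 := mul_le_mul h h1 (by linarith) (mul_nonneg (by linarith) (sSq_nonneg hX2 m))
  linarith

/-- The iterated logarithm grows at most in proportion to its argument. As a consequence, the excess
of a fixed variable over `α s_n / t_n` can only shrink as `n` grows. -/
theorem s_div_t_mono {m n : ℕ} (h : m ≤ n) : 𝓔.s X m / 𝓔.t X m ≤ 𝓔.s X n / 𝓔.t X n := by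
  have h1 := sSq_mono hX2 h
  rcases (sSq_nonneg hX2 m).eq_or_lt with h0 | h0
  · rw [s, ← h0, Real.sqrt_zero, zero_div]
    exact div_nonneg (Real.sqrt_nonneg _) (t_pos n).le
  have hn : 0 < 𝓔.sSq X n := h0.trans_le h1
  rw [div_le_div_iff₀ (t_pos m) (t_pos n)]
  refine le_of_sq_le_sq ?_ (mul_nonneg (Real.sqrt_nonneg _) (t_pos m).le)
  rw [mul_pow, mul_pow, s_sq hX2, s_sq hX2, t_sq, t_sq]
  have h2 := logE_logE_mul_le (c := 𝓔.sSq X n / 𝓔.sSq X m) ((one_le_div h0).mpr h1)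
    (by rw [div_mul_cancel₀ _ h0.ne'] : 𝓔.sSq X n ≤ _)
  rw [div_mul_eq_mul_div, le_div_iff₀ h0] at h2
  linarith

/-! ### Exponential inequality for truncated sums. -/

omit hX2

variable (𝓔 X) in
/-- The sum `∑_{j ≤ n} E[((|X_j| ∧ a_j - c)⁺)^p]`. -/
noncomputable def excessSum (p c : ℝ) (n : ℕ) : ℝ :=
  ∑ j ∈ Finset.Icc 1 n, 𝓔.ex (fun ω => excessPow p (𝓔.a X j) c (X j ω))

variable (𝓔 X) in
/-- The centred sum of the variables with indices in `(n₀, m]`, truncated above at `δ a_j`. -/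
noncomputable def truncSum (δ : ℝ) (n₀ m : ℕ) (ω : Ω) : ℝ :=
  ∑ j ∈ Finset.Ioc n₀ m, (min (X j ω) (δ * 𝓔.a X j) - 𝓔.ex (X j))

theorem excessSum_nonneg (hX : ∀ n, 1 ≤ n → X n ∈ 𝓔.H) {p c : ℝ} (hp : 1 ≤ p) (hc : 0 ≤ c)
    (n : ℕ) : 0 ≤ 𝓔.excessSum X p c n :=
  Finset.sum_nonneg fun j hj => ex_nonneg
    (integ_excessPow (hX j (Finset.mem_Icc.mp hj).1) hp (a_nonneg j) hc)
    fun _ => excessPow_nonneg _ _ _ _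

/-- Chernoff's method: `w j` bounds the log-moment of the `j`-th truncated variable, so the
normalized exponentials have upper expectation at most one and the maximal inequality applies to
their product. The factor 2 comes from the ramps. -/
theorem upperCap_truncSum_le (hX : ∀ n, 1 ≤ n → 𝓔.Integ (X n))
    (hX2 : ∀ n, 1 ≤ n → 𝓔.Integ (fun ω => X n ω ^ 2)) (hindep : 𝓔.IndepSeq X)
    {l α b b₀ δ p : ℝ} (hl : 0 < l) (hα : 0 ≤ α) (hb : l * b = α) (hδ : 0 ≤ δ) (hδ1 : δ ≤ 1)
    (hb₀ : 0 < b₀) (hbb : b₀ ≤ b) (hp : 1 ≤ p) (n₀ n : ℕ) (z : ℝ) :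
    𝓔.upperCap {ω | ∃ m ∈ Finset.Icc 1 n, z ≤ 𝓔.truncSum X δ n₀ m ω} ≤
      ENNReal.ofReal (2 * Real.exp (l ^ 2 / 2 * Real.exp α * 𝓔.sSq X n +
        Real.exp (l * (δ * 𝓔.a X n)) * (2 / b) ^ p * 𝓔.excessSum X p (b₀ / 2) n - l * z)) := by
  set v : ℕ → ℝ := fun j => l ^ 2 / 2 * Real.exp α * 𝓔.ex (fun ω => X j ω ^ 2) +
    Real.exp (l * (δ * 𝓔.a X j)) * (2 / b) ^ p *
      𝓔.ex (fun ω => excessPow p (𝓔.a X j) (b₀ / 2) (X j ω)) with hv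
  set w : ℕ → ℝ := fun j => l * 𝓔.ex (X j) + v j with hw
  -- The factors with `j ≤ n₀` are 1, so the product over `1, …, m` involves only the indices in
  -- `(n₀, m]`.
  set G : ℕ → ℝ → ℝ := fun j u =>
    if n₀ < j then Real.exp (l * min u (δ * 𝓔.a X j)) * Real.exp (-w j) else 1 with hG
  have hb0 : 0 < b := hb₀.trans_le hbb
  have hy : ∀ j, 0 ≤ δ * 𝓔.a X j := fun j => mul_nonneg hδ (a_nonneg j)
  have hya : ∀ j, δ * 𝓔.a X j ≤ 𝓔.a X j := fun j => mul_le_of_le_one_left (a_nonneg j) hδ1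
  have hex0 : ∀ j, 1 ≤ j → 0 ≤ 𝓔.ex (fun ω => excessPow p (𝓔.a X j) (b₀ / 2) (X j ω)) :=
    fun j hj => ex_nonneg (integ_excessPow (hX j hj).mem hp (a_nonneg j) (half_pos hb₀).le)
      fun _ => excessPow_nonneg _ _ _ _
  have hv0 : ∀ j, 1 ≤ j → 0 ≤ v j := fun j hj => by
    have h1 := ex_nonneg (hX2 j hj) fun _ => sq_nonneg _
    have h2 := hex0 j hj
    positivity
  have h0 : ∀ j u, 0 ≤ G j u := fun j u => by
    simp only [hG]; split_ifs <;> positivity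
  have hM : ∀ j u, G j u ≤ Real.exp (l * (δ * 𝓔.a X j)) * Real.exp (-w j) + 1 := fun j u => by
    simp only [hG]
    split_ifs
    · refine le_add_of_le_of_nonneg ?_ zero_le_one
      gcongr
      exact min_le_right _ _
    · exact le_add_of_nonneg_left (by positivity)
  have hK : ∀ j u u', |G j u - G j u'| ≤
      l * Real.exp (l * (δ * 𝓔.a X j)) * Real.exp (-w j) * |u - u'| := fun j u u' => by
    simp only [hG]
    split_ifs
    · rw [← sub_mul, abs_mul, abs_of_pos (Real.exp_pos (-w j)), mul_right_comm]
      gcongr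
      exact abs_exp_min_sub_le hl.le u u'
    · rw [sub_self, abs_zero]
      positivity
  have hG1 : ∀ j, 1 ≤ j → 𝓔.ex (fun ω => G j (X j ω)) ≤ 1 := fun j hj => by
    simp only [hG]
    split_ifs
    · have hI : 𝓔.Integ (fun ω => Real.exp (l * min (X j ω) (δ * 𝓔.a X j))) := by
        refine Integ.of_bdd (comp_lipschitz_mem (f := fun u => Real.exp (l * min u (δ * 𝓔.a X j)))
          (hX j hj).mem (abs_exp_min_sub_le hl.le)) (Real.exp (l * (δ * 𝓔.a X j))) fun ω => ?_
        rw [abs_of_pos (Real.exp_pos _)]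
        gcongr
        exact min_le_right _ _
      simp_rw [mul_comm _ (Real.exp (-w j))]
      rw [ex_const_mul hI (Real.exp_pos _).le]
      have := ex_exp_min_le (hX j hj) (hX2 j hj) hl hα hb (hy j) (hya j) hb₀ hbb hp
      calc _ ≤ Real.exp (-w j) * Real.exp (w j) := by gcongr
        _ = 1 := by rw [← Real.exp_add]; simp
    · rw [ex_const]
  set c := Real.exp (l * z - ∑ j ∈ Finset.Icc 1 n, v j) with hc
  have hsum : ∑ j ∈ Finset.Icc 1 n, v j ≤ l ^ 2 / 2 * Real.exp α * 𝓔.sSq X n +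
      Real.exp (l * (δ * 𝓔.a X n)) * (2 / b) ^ p * 𝓔.excessSum X p (b₀ / 2) n := by
    rw [sSq, excessSum, Finset.mul_sum, Finset.mul_sum, ← Finset.sum_add_distrib]
    refine Finset.sum_le_sum fun j hj => ?_
    rw [Finset.mem_Icc] at hj
    have h1 := hex0 j hj.1
    have h2 := a_mono hX2 hj.2
    simp only [hv]
    gcongr
  have hmono : {ω | ∃ m ∈ Finset.Icc 1 n, z ≤ 𝓔.truncSum X δ n₀ m ω} ⊆
      {ω | ∃ m ∈ Finset.Icc 1 n, c ≤ runProd G m (fun j => X j ω)} := by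
    rintro ω ⟨m, hm, hz⟩
    refine ⟨m, hm, ?_⟩
    have hprod : runProd G m (fun j => X j ω) =
        Real.exp (l * 𝓔.truncSum X δ n₀ m ω - ∑ j ∈ Finset.Ioc n₀ m, v j) := by
      have hset : Finset.Ioc n₀ m = (Finset.Icc 1 m).filter (n₀ < ·) := by
        ext j; simp only [Finset.mem_Ioc, Finset.mem_filter, Finset.mem_Icc]; omega
      rw [truncSum, Finset.mul_sum, ← Finset.sum_sub_distrib, Real.exp_sum, hset,
        Finset.prod_filter]
      refine Finset.prod_congr rfl fun j _ => ?_
      simp only [hG]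
      split_ifs
      · rw [← Real.exp_add]
        congr 1
        simp only [hw]
        ring
      · rfl
    rw [hprod]
    refine Real.exp_le_exp.mpr (sub_le_sub (by gcongr) ?_)
    refine Finset.sum_le_sum_of_subset_of_nonneg (fun j hj => ?_) fun j hj _ =>
      hv0 j (Finset.mem_Icc.mp hj).1
    rw [Finset.mem_Ioc] at hj
    rw [Finset.mem_Icc] at hm ⊢
    omega
  refine (upperCap_mono hmono).trans ((upperCap_exists_runProd_le (Real.exp_pos _) h0 hM hK
    (fun j hj => (hX j hj).mem) hindep hG1 n).trans (ENNReal.ofReal_le_ofReal ?_))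
  rw [div_eq_mul_inv, ← Real.exp_neg]
  gcongr
  linarith

/-- The choice of the rate in the exponential inequality. -/
theorem exists_rate {ε δ d L r : ℝ} (hε : 0 ≤ ε) (hδ : 0 < δ) (hδd : 4 * δ * (d + 1) ≤ 1)
    (hL : 0 < L) (hr0 : 0 ≤ r) (hr : r < 1) :
    ∃ q, 0 < q ∧ q ≤ L ∧ r ≤ Real.exp (-(4 * δ * q)) ∧
      Real.exp (-((1 + ε) * q)) ≤ Real.exp (-((1 + ε) * L)) + r ^ (d + 1) := by
  -- If `r` is this small, `q = L` works. Otherwise `q` solves `exp (-4δq) = r`; then `r^(d+1) = exp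
  -- (-4δ(d+1)q) ≥ exp (-q)`, which is where `4δ(d+1) ≤ 1` is needed.
  rcases le_or_gt r (Real.exp (-(4 * δ * L))) with h | h
  · exact ⟨L, hL, le_rfl, h, le_add_of_nonneg_right (Real.rpow_nonneg hr0 _)⟩
  have hr1 : 0 < r := (Real.exp_pos _).trans h
  have hlog : Real.log r < 0 := Real.log_neg hr1 hr
  have hlog' : -(4 * δ * L) < Real.log r := (Real.lt_log_iff_exp_lt hr1).mpr h
  have hq : 4 * δ * (-Real.log r / (4 * δ)) = -Real.log r := by field_simp
  have hq0 : 0 < -Real.log r / (4 * δ) := div_pos (by linarith) (by positivity)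
  refine ⟨-Real.log r / (4 * δ), hq0, ?_, ?_, ?_⟩
  · rw [div_le_iff₀ (by positivity)]; linarith
  · rw [hq, neg_neg, Real.exp_log hr1]
  · refine le_add_of_nonneg_of_le (Real.exp_pos _).le ?_
    rw [Real.rpow_def_of_pos hr1, Real.exp_le_exp]
    set q := -Real.log r / (4 * δ)
    have : Real.log r = -(4 * δ * q) := by linarith
    rw [this]
    nlinarith

/-- The `p`-th power of `u ≤ exp u` at `u = δ q / p`; the bound does not depend on `q`. -/
theorem rpow_mul_exp_neg_le {k δ p q : ℝ} (hk : 0 ≤ k) (hδ : 0 < δ) (hp : 0 < p) (hq : 0 ≤ q) :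
    (k * q) ^ p * Real.exp (-(δ * q)) ≤ (k * p / δ) ^ p := by
  have h1 : k * q ≤ k * p / δ * Real.exp (δ * q / p) := by
    have h2 := Real.add_one_le_exp (δ * q / p)
    have h3 : k * q = k * p / δ * (δ * q / p) := by field_simp
    rw [h3]
    gcongr
    linarith
  have h2 : (k * q) ^ p ≤ (k * p / δ) ^ p * Real.exp (δ * q) := by
    refine (Real.rpow_le_rpow (by positivity) h1 hp.le).trans_eq ?_
    rw [Real.mul_rpow (by positivity) (Real.exp_pos _).le, ← Real.exp_mul]
    congr 2
    field_simp
  calc _ ≤ (k * p / δ) ^ p * Real.exp (δ * q) * Real.exp (-(δ * q)) := by gcongr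
    _ = _ := by rw [mul_assoc, ← Real.exp_add]; simp

/-- The maximal probability of a large deviation of the truncated sum up to one fixed time. -/
theorem exists_upperCap_truncSum_le (hX : ∀ n, 1 ≤ n → 𝓔.Integ (X n))
    (hX2 : ∀ n, 1 ≤ n → 𝓔.Integ (fun ω => X n ω ^ 2)) (hindep : 𝓔.IndepSeq X)
    {ε α δ p d : ℝ} (hα : 0 < α) (hαε : Real.exp α = 1 + ε) (hδ : 0 < δ) (hδ1 : δ ≤ 1)
    (hδd : 4 * δ * (d + 1) ≤ 1) (hd : 0 ≤ d + 1) (hp : 1 ≤ p) :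
    ∃ C : ℝ, 0 ≤ C ∧ ∀ n₀ n : ℕ, 0 < 𝓔.sSq X n →
      𝓔.upperCap {ω | ∃ m ∈ Finset.Icc 1 n, (1 + ε) * 𝓔.a X n ≤ 𝓔.truncSum X δ n₀ m ω} ≤
      ENNReal.ofReal (C * (Real.exp (-((1 + ε) * logE (logE (𝓔.sSq X n)))) +
        (𝓔.excessSum X p (α / 2 * 𝓔.s X n / 𝓔.t X n) n / 𝓔.a X n ^ p) ^ (d + 1))) := by
  have hε : 0 < ε := by
    have := Real.add_one_lt_exp hα.ne'
    linarith
  set C' := (4 / α * p / (2 * δ)) ^ p with hC'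
  have hC'0 : 0 ≤ C' := by positivity
  have hC1 : 1 ≤ 2 * Real.exp C' := by
    have := Real.one_le_exp hC'0
    linarith
  refine ⟨2 * Real.exp C', by positivity, fun n₀ n hn => ?_⟩
  set L := logE (logE (𝓔.sSq X n)) with hL
  have hL1 : 1 ≤ L := one_le_logE _
  have hs := s_pos hn
  have ht := t_pos (𝓔 := 𝓔) (X := X) n
  have ha := a_pos hn
  have hap : 0 < 𝓔.a X n ^ p := Real.rpow_pos_of_pos ha p
  have hb₀ : 0 < α * 𝓔.s X n / 𝓔.t X n := by positivity
  have hb₀' : α / 2 * 𝓔.s X n / 𝓔.t X n = α * 𝓔.s X n / 𝓔.t X n / 2 := by ring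
  have hΛ : 0 ≤ 𝓔.excessSum X p (α / 2 * 𝓔.s X n / 𝓔.t X n) n :=
    excessSum_nonneg (fun j hj => (hX j hj).mem) hp (by positivity) n
  set r := 𝓔.excessSum X p (α / 2 * 𝓔.s X n / 𝓔.t X n) n / 𝓔.a X n ^ p with hr
  have hr0 : 0 ≤ r := div_nonneg hΛ hap.le
  have hΛr : 𝓔.excessSum X p (α / 2 * 𝓔.s X n / 𝓔.t X n) n = 𝓔.a X n ^ p * r := by
    rw [hr]; field_simp
  -- For `r ≥ 1` the right-hand side is at least 1 and the bound is trivial.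
  rcases le_or_gt 1 r with hr1 | hr1
  · refine (upperCap_le_one _).trans ?_
    rw [ENNReal.one_le_ofReal]
    have h1 := Real.one_le_rpow hr1 hd
    have h2 := Real.exp_pos (-((1 + ε) * L))
    nlinarith
  obtain ⟨q, hq0, hqL, hrq, hqr⟩ := exists_rate (d := d) hε.le hδ hδd (one_pos.trans_le hL1) hr0 hr1
  -- With `l = β t_n / s_n` one has `l a_n = 2q` and `l^2 s_n^2 = 2βq`. The variance term is then at
  -- most `(1+ε)q` against `l (1+ε) a_n = 2(1+ε)q`, leaving `-(1+ε)q`. Moreover `β ≤ 1` says that `α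
  -- / l` is at least `α s_n / t_n`.
  set β := q / L with hβ
  have hβ0 : 0 < β := by positivity
  have hβ1 : β ≤ 1 := (div_le_one (by linarith)).mpr hqL
  have hβL : β * L = q := by rw [hβ]; field_simp
  set l := β * 𝓔.t X n / 𝓔.s X n with hl
  have hl0 : 0 < l := by positivity
  have hla : l * 𝓔.a X n = 2 * q := by
    rw [hl, a, ← hβL]
    have := t_sq (𝓔 := 𝓔) (X := X) n
    field_simp
    rw [this]
  have hls : l ^ 2 * 𝓔.sSq X n = 2 * (β * q) := by
    rw [hl, ← s_sq hX2]
    have := t_sq (𝓔 := 𝓔) (X := X) n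
    field_simp
    rw [this, ← hβL]; ring
  refine (upperCap_truncSum_le hX hX2 hindep hl0 hα.le (b := α / l) (by field_simp) hδ.le hδ1 hb₀
    ?_ hp n₀ n ((1 + ε) * 𝓔.a X n)).trans (ENNReal.ofReal_le_ofReal ?_)
  · rw [hl, div_div_eq_mul_div]
    rw [div_le_div_iff₀ ht (by positivity)]
    have : 0 < α * 𝓔.s X n * 𝓔.t X n := by positivity
    nlinarith
  rw [mul_assoc 2]
  refine mul_le_mul_of_nonneg_left ?_ zero_le_two
  refine le_trans ?_ (mul_le_mul_of_nonneg_left hqr (Real.exp_pos _).le)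
  rw [← Real.exp_add, Real.exp_le_exp, hαε, ← hb₀', hΛr]
  have h1 : l ^ 2 / 2 * (1 + ε) * 𝓔.sSq X n ≤ (1 + ε) * q := by
    have : l ^ 2 / 2 * (1 + ε) * 𝓔.sSq X n = (1 + ε) * (β * q) := by linear_combination (1 + ε) / 2 * hls
    rw [this]
    gcongr
    exact mul_le_of_le_one_left hq0.le hβ1
  -- Truncation at `δ a_n` costs `exp (2δq)`, while `r ≤ exp (-4δq)`; the remaining `exp (-2δq)`
  -- absorbs the power `q^p`.
  have h2 : Real.exp (l * (δ * 𝓔.a X n)) * (2 / (α / l)) ^ p * (𝓔.a X n ^ p * r) ≤ C' := by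
    have h3 : l * (δ * 𝓔.a X n) = 2 * δ * q := by linear_combination δ * hla
    have h4 : (2 / (α / l)) ^ p * 𝓔.a X n ^ p = (4 / α * q) ^ p := by
      rw [← Real.mul_rpow (by positivity) ha.le]
      congr 1
      have : 2 / (α / l) * 𝓔.a X n = 2 / α * (l * 𝓔.a X n) := by field_simp
      rw [this, hla]; ring
    calc _ = (4 / α * q) ^ p * Real.exp (2 * δ * q) * r := by rw [h3, ← h4]; ring
      _ ≤ (4 / α * q) ^ p * Real.exp (2 * δ * q) * Real.exp (-(4 * δ * q)) := by gcongr
      _ = (4 / α * q) ^ p * Real.exp (-(2 * δ * q)) := by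
        rw [mul_assoc, ← Real.exp_add]; ring_nf
      _ ≤ C' := rpow_mul_exp_neg_le (by positivity) (by positivity) (by linarith) hq0.le
  have h5 : l * ((1 + ε) * 𝓔.a X n) = 2 * ((1 + ε) * q) := by linear_combination (1 + ε) * hla
  rw [h5]
  linarith

end SublinearExpectation

/-! ### Geometric blocks and summation along their ends. -/

section Blocks

variable {f : ℕ → ℝ} {θ : ℝ}

/-- The indices `n` with `θ^k ≤ f n < θ^(k+1)`. -/
def block (f : ℕ → ℝ) (θ : ℝ) (k : ℕ) : Set ℕ := {n | θ ^ k ≤ f n ∧ f n < θ ^ (k + 1)}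

/-- The last index of a block. -/
noncomputable def blockEnd (f : ℕ → ℝ) (θ : ℝ) (k : ℕ) : ℕ := sSup (block f θ k)

theorem bddAbove_block (hf : Tendsto f atTop atTop) (k : ℕ) : BddAbove (block f θ k) := by
  obtain ⟨N, hN⟩ := (hf.eventually_ge_atTop (θ ^ (k + 1))).exists_forall_of_atTop
  refine ⟨N, fun n hn => ?_⟩
  by_contra! h
  exact absurd (hN n h.le) (not_le.mpr hn.2)

theorem blockEnd_mem (hf : Tendsto f atTop atTop) {k : ℕ} (h : (block f θ k).Nonempty) :
    blockEnd f θ k ∈ block f θ k :=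
  Nat.sSup_mem h (bddAbove_block hf k)

theorem le_blockEnd (hf : Tendsto f atTop atTop) {k n : ℕ} (h : n ∈ block f θ k) :
    n ≤ blockEnd f θ k :=
  le_csSup (bddAbove_block hf k) h

/-- The nonzero terms start at the first `k₀` with `x < θ^(k₀+1)`, and from there are dominated by
`θ * θ^{-(k - k₀)}`; hence a bound uniform in `x`. -/
theorem tsum_geometric_block_le (hθ : 1 < θ) (x : ℝ) :
    ∑' k : ℕ, (if x < θ ^ (k + 1) then ENNReal.ofReal (x / θ ^ k) else 0) ≤
      ENNReal.ofReal (θ * (1 - θ⁻¹)⁻¹) := by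
  have hθ0 : 0 < θ := by linarith
  have hex : ∃ k : ℕ, x < θ ^ (k + 1) := by
    obtain ⟨k, hk⟩ := pow_unbounded_of_one_lt x hθ
    exact ⟨k, hk.trans_le (pow_le_pow_right₀ hθ.le (by omega))⟩
  obtain ⟨k₀, h1, hmin⟩ : ∃ k₀ : ℕ, x < θ ^ (k₀ + 1) ∧ ∀ k < k₀, ¬ x < θ ^ (k + 1) := by
    classical
    exact ⟨Nat.find hex, Nat.find_spec hex, fun k hk => Nat.find_min hex hk⟩
  rw [← ENNReal.summable.sum_add_tsum_nat_add' (k := k₀), Finset.sum_eq_zero, zero_add]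
  · have hg : HasSum (fun k : ℕ => θ * θ⁻¹ ^ k) (θ * (1 - θ⁻¹)⁻¹) :=
      (hasSum_geometric_of_lt_one (by positivity) (inv_lt_one_of_one_lt₀ hθ)).mul_left θ
    rw [← hg.tsum_eq, ENNReal.ofReal_tsum_of_nonneg (fun k => by positivity) hg.summable]
    refine ENNReal.tsum_le_tsum fun k => ?_
    split_ifs
    · refine ENNReal.ofReal_le_ofReal ?_
      rw [div_le_iff₀ (by positivity), pow_add, inv_pow]
      have : θ * (θ ^ k)⁻¹ * (θ ^ k * θ ^ k₀) = θ ^ (k₀ + 1) := by field_simp; ring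
      rw [this]
      exact h1.le
    · exact zero_le
  · intro k hk
    rw [if_neg (hmin k (Finset.mem_range.mp hk))]

open Classical in
/-- A Kronecker-type lemma: normalized sums along the ends of geometric blocks are summable. -/
theorem tsum_blockEnd_lt_top (hf : Tendsto f atTop atTop) (hθ : 1 < θ) {N : ℕ}
    {A R c : ℕ → ℝ} (hA : ∀ n, N ≤ n → 0 < A n) (hfN : ∀ n, N ≤ n → 0 < f n)
    (hAf : ∀ j n, N ≤ j → j ≤ n → A j / A n ≤ f j / f n)
    (hmono : Monotone f) (hc : ∀ n, N ≤ n → 0 ≤ c n)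
    (hR : ∀ n, N ≤ n → R n ≤ ∑ j ∈ Finset.Icc N n, c j)
    (hsum : Summable fun n : ℕ => c (n + N) / A (n + N)) :
    ∑' k : ℕ, (if (block f θ k).Nonempty ∧ N ≤ blockEnd f θ k then
      ENNReal.ofReal (R (blockEnd f θ k) / A (blockEnd f θ k)) else 0) < ⊤ := by
  have hθ0 : 0 < θ := by linarith
  set g : ℕ → ℕ → ℝ≥0∞ := fun j k =>
    if f (j + N) < θ ^ (k + 1) then ENNReal.ofReal (f (j + N) / θ ^ k) else 0 with hg
  have hle : ∀ k : ℕ, (if (block f θ k).Nonempty ∧ N ≤ blockEnd f θ k then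
      ENNReal.ofReal (R (blockEnd f θ k) / A (blockEnd f θ k)) else 0) ≤
      ∑' j : ℕ, ENNReal.ofReal (c (j + N) / A (j + N)) * g j k := by
    intro k
    split_ifs with h
    swap
    · exact zero_le
    obtain ⟨hne, hNn⟩ := h
    set n := blockEnd f θ k with hn
    obtain ⟨hn1, hn2⟩ := blockEnd_mem hf hne
    rw [← hn] at hn1 hn2
    have hθk : 0 < θ ^ k := by positivity
    -- Replacing `1 / A n` by `(1 / A j) * f j / θ^k` decouples `j` from the block end. After
    -- exchanging the sums, the sum over `k` is geometric, uniformly in `j`.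
    have h1 : R n / A n ≤ ∑ j ∈ Finset.Icc N n, c j / A j * (f j / θ ^ k) := by
      rw [div_le_iff₀ (hA n hNn), Finset.sum_mul]
      refine (hR n hNn).trans (Finset.sum_le_sum fun j hj => ?_)
      rw [Finset.mem_Icc] at hj
      have h2 : A j / A n ≤ f j / θ ^ k :=
        (hAf j n hj.1 hj.2).trans (div_le_div_of_nonneg_left (hfN j hj.1).le hθk hn1)
      rw [div_le_iff₀ (hA n hNn)] at h2
      have hAj := hA j hj.1
      have := mul_le_mul_of_nonneg_left h2 (div_nonneg (hc j hj.1) hAj.le)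
      rw [div_mul_cancel₀ _ hAj.ne'] at this
      linarith
    refine (ENNReal.ofReal_le_ofReal h1).trans ?_
    rw [ENNReal.ofReal_sum_of_nonneg]
    · have h3 : Finset.Icc N n = (Finset.range (n + 1 - N)).map (addRightEmbedding N) := by
        ext j
        simp only [Finset.mem_Icc, Finset.mem_map, Finset.mem_range, addRightEmbedding_apply]
        exact ⟨fun h => ⟨j - N, by omega, by omega⟩, by rintro ⟨i, hi, rfl⟩; omega⟩
      rw [h3, Finset.sum_map]
      refine le_trans (Finset.sum_le_sum fun j hj => ?_)
        (ENNReal.sum_le_tsum (Finset.range (n + 1 - N)))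
      rw [Finset.mem_range] at hj
      simp only [addRightEmbedding_apply, hg]
      rw [if_pos ((hmono (by omega)).trans_lt hn2), ENNReal.ofReal_mul]
      exact div_nonneg (hc _ (by omega)) (hA _ (by omega)).le
    · intro j hj
      rw [Finset.mem_Icc] at hj
      exact mul_nonneg (div_nonneg (hc j hj.1) (hA j hj.1).le)
        (div_nonneg (hfN j hj.1).le hθk.le)
  refine (ENNReal.tsum_le_tsum hle).trans_lt ?_
  rw [ENNReal.tsum_comm]
  simp_rw [ENNReal.tsum_mul_left]
  refine (ENNReal.tsum_le_tsum fun j => mul_le_mul_right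
    (tsum_geometric_block_le hθ (f (j + N))) _).trans_lt ?_
  rw [ENNReal.tsum_mul_right, ← ENNReal.ofReal_tsum_of_nonneg (fun n =>
    div_nonneg (hc _ (by omega)) (hA _ (by omega)).le) hsum]
  exact ENNReal.mul_lt_top ENNReal.ofReal_lt_top ENNReal.ofReal_lt_top

/-- On the `k`-th block `logE x` is at least a multiple of `k + 1`, so the Gaussian term of the
exponential inequality is summable over blocks. -/
theorem exists_exp_neg_logE_le (hθ : 1 < θ) {ε : ℝ} (hε : 0 < ε) :
    ∃ C : ℝ, 0 ≤ C ∧ ∀ (k : ℕ) (x : ℝ), θ ^ k ≤ x →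
      Real.exp (-((1 + ε) * logE (logE x))) ≤ C * ((k + 1 : ℕ) : ℝ) ^ (-(1 + ε)) := by
  have hlog : 0 < Real.log θ := Real.log_pos hθ
  set c := min 1 (Real.log θ) / 2 with hc
  have hc0 : 0 < c := half_pos (lt_min one_pos hlog)
  refine ⟨c ^ (-(1 + ε)), Real.rpow_nonneg hc0.le _, fun k x hx => ?_⟩
  have hθk : 0 < θ ^ k := pow_pos (by linarith) k
  have h1 : c * ((k + 1 : ℕ) : ℝ) ≤ logE x := by
    have h2 : min 1 (Real.log θ) ≤ 1 := min_le_left _ _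
    have h3 : min 1 (Real.log θ) ≤ Real.log θ := min_le_right _ _
    have h4 := one_le_logE x
    have h5 : k * Real.log θ ≤ logE x := by
      rw [← Real.log_pow]
      exact (Real.log_le_log hθk hx).trans (Real.log_le_log (hθk.trans_le hx) (le_max_right _ _))
    push_cast
    rcases Nat.eq_zero_or_pos k with rfl | hk
    · simp only [Nat.cast_zero, zero_add, mul_one]; linarith
    · have hk1 : (1 : ℝ) ≤ k := by exact_mod_cast hk
      have h6 : c * (k + 1) ≤ c * (2 * k) := by gcongr; linarith
      have h7 : c * (2 * k) = k * min 1 (Real.log θ) := by rw [hc]; ring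
      have h8 : k * min 1 (Real.log θ) ≤ k * Real.log θ := by gcongr
      linarith
  have h2 : 0 < c * ((k + 1 : ℕ) : ℝ) := by positivity
  rw [← Real.mul_rpow hc0.le (Nat.cast_nonneg _)]
  have h3 : Real.exp (-((1 + ε) * logE (logE x))) = Real.exp (logE (logE x)) ^ (-(1 + ε)) := by
    rw [← Real.exp_mul]; ring_nf
  rw [h3]
  exact Real.rpow_le_rpow_of_nonpos h2 (h1.trans (le_exp_logE _)) (by linarith)

end Blocks

/-! ### The moment condition along block ends. -/

namespace SublinearExpectation

variable {Ω : Type*} [MeasurableSpace Ω] {𝓔 : SublinearExpectation Ω} {X : ℕ → Ω → ℝ}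

theorem excessSum_le_lambdaBar (hX : ∀ n, 1 ≤ n → X n ∈ 𝓔.H)
    (hX2 : ∀ n, 1 ≤ n → 𝓔.Integ (fun ω => X n ω ^ 2)) {p α : ℝ} (hp : 1 ≤ p) (hα : 0 ≤ α) (n : ℕ) :
    𝓔.excessSum X p (α * 𝓔.s X n / 𝓔.t X n) n ≤ 𝓔.LambdaBar X p α n := by
  have hc : 0 ≤ α * 𝓔.s X n / 𝓔.t X n :=
    div_nonneg (mul_nonneg hα (Real.sqrt_nonneg _)) (t_pos n).le
  refine Finset.sum_le_sum fun j hj => ?_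
  rw [Finset.mem_Icc] at hj
  exact ex_mono (integ_excessPow (hX j hj.1) hp (a_nonneg j) hc)
    (integ_excessPow (hX j hj.1) hp (a_nonneg n) hc)
    fun ω => excessPow_mono (by linarith) (a_mono hX2 hj.2) le_rfl _

/-- Old terms do not increase, since the level `α s_n / t_n` rises while their cap stays at `a_j`.
This is why `excessSum` caps at `a_j` and not, like `LambdaBar`, at `a_n`. -/
theorem excessSum_succ_le (hX : ∀ n, 1 ≤ n → X n ∈ 𝓔.H)
    (hX2 : ∀ n, 1 ≤ n → 𝓔.Integ (fun ω => X n ω ^ 2)) {p α : ℝ} (hp : 1 ≤ p) (hα : 0 ≤ α) (n : ℕ) :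
    𝓔.excessSum X p (α * 𝓔.s X (n + 1) / 𝓔.t X (n + 1)) (n + 1) ≤
      𝓔.excessSum X p (α * 𝓔.s X n / 𝓔.t X n) n + 𝓔.GammaBar X p α (n + 1) := by
  have hc : ∀ n, 0 ≤ α * 𝓔.s X n / 𝓔.t X n := fun n =>
    div_nonneg (mul_nonneg hα (Real.sqrt_nonneg _)) (t_pos n).le
  rw [excessSum, Finset.sum_Icc_succ_top (by omega)]
  refine add_le_add (Finset.sum_le_sum fun j hj => ?_) le_rfl
  rw [Finset.mem_Icc] at hj
  refine ex_mono (integ_excessPow (hX j hj.1) hp (a_nonneg j) (hc _))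
    (integ_excessPow (hX j hj.1) hp (a_nonneg j) (hc _))
    fun ω => excessPow_mono (by linarith) le_rfl ?_ _
  rw [mul_div_assoc, mul_div_assoc]
  exact mul_le_mul_of_nonneg_left (s_div_t_mono hX2 (by omega)) hα

theorem gammaBar_nonneg (hX : ∀ n, 1 ≤ n → X n ∈ 𝓔.H) {p α : ℝ} (hp : 1 ≤ p) (hα : 0 ≤ α) {n : ℕ}
    (hn : 1 ≤ n) : 0 ≤ 𝓔.GammaBar X p α n :=
  ex_nonneg (integ_excessPow (hX n hn) hp (a_nonneg n)
    (div_nonneg (mul_nonneg hα (Real.sqrt_nonneg _)) (t_pos n).le))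
    fun _ => excessPow_nonneg _ _ _ _

/-- By the mean value bound, an increase from `x` to `y` adds at most `(d+1) y^d (y - x)`, where `y
≤ Λ` and `y - x ≤ Γ`. The terms of the moment series thus control the increments of
`excessSum^(d+1)`. -/
theorem excessSum_rpow_le (hX : ∀ n, 1 ≤ n → X n ∈ 𝓔.H)
    (hX2 : ∀ n, 1 ≤ n → 𝓔.Integ (fun ω => X n ω ^ 2)) {p α d : ℝ} (hp : 1 ≤ p) (hα : 0 ≤ α)
    (hd : 0 ≤ d) (n : ℕ) :
    𝓔.excessSum X p (α * 𝓔.s X (n + 1) / 𝓔.t X (n + 1)) (n + 1) ^ (d + 1) ≤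
      𝓔.excessSum X p (α * 𝓔.s X n / 𝓔.t X n) n ^ (d + 1) +
        (d + 1) * (𝓔.GammaBar X p α (n + 1) * 𝓔.LambdaBar X p α (n + 1) ^ d) := by
  have h1 := excessSum_succ_le hX hX2 hp hα n
  have h2 := excessSum_le_lambdaBar hX hX2 hp hα (n + 1)
  have h3 := gammaBar_nonneg hX hp hα (n := n + 1) (by omega)
  have hc : ∀ n, 0 ≤ α * 𝓔.s X n / 𝓔.t X n := fun n =>
    div_nonneg (mul_nonneg hα (Real.sqrt_nonneg _)) (t_pos n).le
  have h4 := excessSum_nonneg hX hp (hc n) n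
  have h5 := excessSum_nonneg hX hp (hc (n + 1)) (n + 1)
  set x := 𝓔.excessSum X p (α * 𝓔.s X n / 𝓔.t X n) n
  set y := 𝓔.excessSum X p (α * 𝓔.s X (n + 1) / 𝓔.t X (n + 1)) (n + 1)
  have h6 : 0 ≤ 𝓔.LambdaBar X p α (n + 1) ^ d := Real.rpow_nonneg (h5.trans h2) d
  rcases le_total y x with h | h
  · have := Real.rpow_le_rpow h5 h (by linarith : 0 ≤ d + 1)
    have : 0 ≤ (d + 1) * (𝓔.GammaBar X p α (n + 1) * 𝓔.LambdaBar X p α (n + 1) ^ d) := by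
      positivity
    linarith
  · have h7 := Real.rpow_sub_rpow_le h4 h (by linarith : 1 ≤ d + 1)
    rw [add_sub_cancel_right] at h7
    have h8 : y ^ d ≤ 𝓔.LambdaBar X p α (n + 1) ^ d := Real.rpow_le_rpow h5 h2 hd
    have h9 : (d + 1) * y ^ d * (y - x) ≤
        (d + 1) * (𝓔.GammaBar X p α (n + 1) * 𝓔.LambdaBar X p α (n + 1) ^ d) := by
      rw [mul_assoc, mul_comm (y ^ d)]
      have : 0 ≤ y ^ d := Real.rpow_nonneg h5 d
      have : 0 ≤ y - x := by linarith
      gcongr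
      linarith
    linarith

open Classical in
/-- The moment condition is inherited by the ends of geometric blocks. -/
theorem tsum_excessSum_blockEnd_lt_top (hX : ∀ n, 1 ≤ n → X n ∈ 𝓔.H)
    (hX2 : ∀ n, 1 ≤ n → 𝓔.Integ (fun ω => X n ω ^ 2)) (hs : Tendsto (𝓔.sSq X) atTop atTop)
    {p α d θ : ℝ} (hp : 2 ≤ p) (hα : 0 ≤ α) (hd : 0 ≤ d) (hθ : 1 < θ)
    (hsum : Summable (fun n : ℕ => 𝓔.GammaBar X p α (n + 1) / 𝓔.a X (n + 1) ^ p *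
      (𝓔.LambdaBar X p α (n + 1) / 𝓔.a X (n + 1) ^ p) ^ d)) {N : ℕ} (hN : 0 < 𝓔.sSq X N) :
    ∑' k : ℕ, (if (block (𝓔.sSq X) θ k).Nonempty ∧ N ≤ blockEnd (𝓔.sSq X) θ k then
      ENNReal.ofReal ((𝓔.excessSum X p (α * 𝓔.s X (blockEnd (𝓔.sSq X) θ k) /
        𝓔.t X (blockEnd (𝓔.sSq X) θ k)) (blockEnd (𝓔.sSq X) θ k) /
          𝓔.a X (blockEnd (𝓔.sSq X) θ k) ^ p) ^ (d + 1)) else 0) < ⊤ := by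
  have hmono := sSq_mono hX2
  have hpos : ∀ n, N ≤ n → 0 < 𝓔.sSq X n := fun n hn => hN.trans_le (hmono hn)
  have hc : ∀ n, 0 ≤ α * 𝓔.s X n / 𝓔.t X n := fun n =>
    div_nonneg (mul_nonneg hα (Real.sqrt_nonneg _)) (t_pos n).le
  have hE := fun n => excessSum_nonneg hX (by linarith : 1 ≤ p) (hc n) n
  set R : ℕ → ℝ := fun n => 𝓔.excessSum X p (α * 𝓔.s X n / 𝓔.t X n) n ^ (d + 1) with hR
  set A : ℕ → ℝ := fun n => (𝓔.a X n ^ p) ^ (d + 1) with hA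
  -- The term at `N` carries the initial value, so that the partial sums of `c` dominate `R`.
  set c : ℕ → ℝ := fun n => if n = N then R N else
    (d + 1) * (𝓔.GammaBar X p α n * 𝓔.LambdaBar X p α n ^ d) with hcdef
  have hA0 : ∀ n, N ≤ n → 0 < A n := fun n hn =>
    Real.rpow_pos_of_pos (Real.rpow_pos_of_pos (a_pos (hpos n hn)) _) _
  have hN1 : 1 ≤ N := by
    rcases Nat.eq_zero_or_pos N with rfl | h
    · simp [sSq] at hN
    · exact h
  have hL0 : ∀ n, 0 ≤ 𝓔.LambdaBar X p α n := fun n =>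
    (hE n).trans (excessSum_le_lambdaBar hX hX2 (by linarith) hα n)
  have hc0 : ∀ n, N ≤ n → 0 ≤ c n := fun n hn => by
    have h1 := gammaBar_nonneg hX (by linarith : 1 ≤ p) hα (hN1.trans hn)
    have h2 := Real.rpow_nonneg (hL0 n) d
    have h3 := Real.rpow_nonneg (hE N) (d + 1)
    simp only [hcdef]
    split_ifs
    · exact h3
    · positivity
  have key := tsum_blockEnd_lt_top (f := 𝓔.sSq X) (R := R) (A := A) (c := c) hs hθ hA0 hpos ?_
    hmono hc0 ?_ ?_
  · refine lt_of_eq_of_lt (tsum_congr fun k => ?_) key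
    split_ifs
    · rw [Real.div_rpow (hE _) (Real.rpow_nonneg (a_nonneg _) _)]
    · rfl
  -- Here `p ≥ 2` enters: as `a_j / a_n ≤ 1`, its power `p(d+1)` is at most its square, which is at
  -- most `s_j^2 / s_n^2`.
  · intro j n hj hjn
    have haj := a_pos (hpos j hj)
    have han := a_pos (hpos n (hj.trans hjn))
    have hfn := hpos n (hj.trans hjn)
    have h1 : 𝓔.a X j / 𝓔.a X n ≤ 1 := (div_le_one han).mpr (a_mono hX2 hjn)
    have h2 : A j / A n = (𝓔.a X j / 𝓔.a X n) ^ (p * (d + 1)) := by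
      simp only [hA]
      rw [← Real.rpow_mul haj.le, ← Real.rpow_mul han.le, Real.div_rpow haj.le han.le]
    rw [h2]
    calc _ ≤ (𝓔.a X j / 𝓔.a X n) ^ (2 : ℝ) :=
          Real.rpow_le_rpow_of_exponent_ge (by positivity) h1 (by nlinarith)
      _ = 𝓔.a X j ^ 2 / 𝓔.a X n ^ 2 := by rw [Real.rpow_two, div_pow]
      _ ≤ 𝓔.sSq X j / 𝓔.sSq X n := by
          rw [div_le_div_iff₀ (by positivity) hfn, a_sq hX2, a_sq hX2]
          have h3 := logE_mono (logE_mono (hmono hjn))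
          have h4 : 0 ≤ 𝓔.sSq X j * 𝓔.sSq X n := mul_nonneg (hpos j hj).le hfn.le
          nlinarith [mul_le_mul_of_nonneg_left h3 h4]
  · intro n hn
    induction n, hn using Nat.le_induction with
    | base => simp [hcdef]
    | succ n hn ih =>
      rw [Finset.sum_Icc_succ_top (by omega)]
      have h1 := excessSum_rpow_le hX hX2 (by linarith : 1 ≤ p) hα hd n
      have h2 : c (n + 1) = (d + 1) * (𝓔.GammaBar X p α (n + 1) *
          𝓔.LambdaBar X p α (n + 1) ^ d) := if_neg (by omega)
      rw [h2]
      exact h1.trans (by gcongr)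
  · rw [← summable_nat_add_iff 1]
    have h1 := ((summable_nat_add_iff N).mpr hsum).mul_left (d + 1)
    refine h1.congr fun n => ?_
    have h2 : n + 1 + N = n + N + 1 := by omega
    have h3 : c (n + N + 1) = (d + 1) * (𝓔.GammaBar X p α (n + N + 1) *
          𝓔.LambdaBar X p α (n + N + 1) ^ d) := if_neg (by omega)
    have hap : 0 < 𝓔.a X (n + N + 1) ^ p :=
      Real.rpow_pos_of_pos (a_pos (hpos _ (by omega))) _
    rw [h2, h3, Real.div_rpow (hL0 _) hap.le]
    simp only [hA]
    rw [Real.rpow_add_one hap.ne']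
    have := Real.rpow_pos_of_pos hap d
    field_simp

end SublinearExpectation

/-! ### Coverings of small total capacity. -/

namespace SublinearExpectation

theorem iUnion_subset_of_finite_cover {Ω : Type*} {A B : ℕ → Set Ω} (hc : ∀ m, ∃ F : Finset ℕ, A m ⊆ ⋃ i ∈ F, B i) :
    ⋃ m, A m ⊆ ⋃ i, B i := by
  refine Set.iUnion_subset fun m => ?_
  obtain ⟨F, hF⟩ := hc m
  exact hF.trans (Set.iUnion₂_subset fun i _ => Set.subset_iUnion B i)

variable {Ω : Type*} [MeasurableSpace Ω] {𝓔 : SublinearExpectation Ω}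

/-- The sequence of sets `A` is covered by measurable sets of total upper capacity at most `η`,
each member by finitely many of them. -/
def HasCover (𝓔 : SublinearExpectation Ω) (A : ℕ → Set Ω) (η : ℝ≥0∞) : Prop :=
  ∃ B : ℕ → Set Ω, (∀ i, MeasurableSet (B i)) ∧ ∑' i, 𝓔.upperCap (B i) ≤ η ∧
    ∀ m, ∃ F : Finset ℕ, A m ⊆ ⋃ i ∈ F, B i

namespace HasCover

variable {A A' : ℕ → Set Ω} {η η' : ℝ≥0∞}

theorem mono (h : 𝓔.HasCover A η) (hA : ∀ m, A' m ⊆ A m) (hη : η ≤ η') : 𝓔.HasCover A' η' := by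
  obtain ⟨B, hB, hsum, hc⟩ := h
  refine ⟨B, hB, hsum.trans hη, fun m => ?_⟩
  obtain ⟨F, hF⟩ := hc m
  exact ⟨F, (hA m).trans hF⟩

theorem of_countable {ι : Type*} [Denumerable ι] {B : ι → Set Ω} (hB : ∀ i, MeasurableSet (B i))
    (hsum : ∑' i, 𝓔.upperCap (B i) ≤ η) (hA : ∀ m, ∃ F : Finset ι, A m ⊆ ⋃ i ∈ F, B i) :
    𝓔.HasCover A η := by
  refine ⟨fun i => B ((Denumerable.eqv ι).symm i), fun i => hB _, ?_, fun m => ?_⟩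
  · rw [Equiv.tsum_eq (Denumerable.eqv ι).symm (fun i => 𝓔.upperCap (B i))]
    exact hsum
  · obtain ⟨F, hF⟩ := hA m
    refine ⟨F.map (Denumerable.eqv ι).toEmbedding, hF.trans ?_⟩
    refine Set.iUnion₂_subset fun i hi ω hω => Set.mem_iUnion₂.mpr
      ⟨Denumerable.eqv ι i, Finset.mem_map_of_mem _ hi, ?_⟩
    simpa using hω

theorem union (h : 𝓔.HasCover A η) (h' : 𝓔.HasCover A' η') :
    𝓔.HasCover (fun m => A m ∪ A' m) (η + η') := by
  obtain ⟨B, hB, hsum, hc⟩ := h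
  obtain ⟨B', hB', hsum', hc'⟩ := h'
  refine of_countable (B := Sum.elim B B') (fun i => ?_) ?_ fun m => ?_
  · cases i with
    | inl i => exact hB i
    | inr i => exact hB' i
  · rw [ENNReal.summable.tsum_sum ENNReal.summable]
    exact add_le_add hsum hsum'
  · obtain ⟨F, hF⟩ := hc m
    obtain ⟨F', hF'⟩ := hc' m
    refine ⟨F.disjSum F', Set.union_subset (hF.trans ?_) (hF'.trans ?_)⟩
    · exact Set.iUnion₂_subset fun i hi ω hω => Set.mem_iUnion₂.mpr
        ⟨Sum.inl i, Finset.inl_mem_disjSum.mpr hi, hω⟩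
    · exact Set.iUnion₂_subset fun i hi ω hω => Set.mem_iUnion₂.mpr
        ⟨Sum.inr i, Finset.inr_mem_disjSum.mpr hi, hω⟩

theorem single {D : Set Ω} (hD : MeasurableSet D) (h : 𝓔.upperCap D ≤ η) :
    𝓔.HasCover (fun _ => D) η := by
  refine ⟨fun i => if i = 0 then D else ∅, fun i => ?_, ?_, fun m => ⟨{0}, by simp⟩⟩
  · dsimp only
    split_ifs
    · exact hD
    · exact MeasurableSet.empty
  · rw [tsum_eq_single 0 fun i hi => by simp only [if_neg hi, upperCap_empty]]
    simpa using h

/-- Finitely many times involve only finitely many covering sets, so finite sub-additivity of `V`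
suffices and the bound is uniform in the horizon. -/
theorem capacity_le {V : Set Ω → ℝ≥0∞} (hV : IsCapacity V) (hVsub : IsSubadditiveCap V)
    (hVE : 𝓔.Dominates V) (h : 𝓔.HasCover A η) {G : Set Ω} (hG : MeasurableSet G) {s : Finset ℕ}
    (hGA : G ⊆ ⋃ m ∈ s, A m) : V G ≤ η := by
  classical
  obtain ⟨B, hB, hsum, hc⟩ := h
  have hfin : ∀ F : Finset ℕ, V (⋃ i ∈ F, B i) ≤ ∑ i ∈ F, 𝓔.upperCap (B i) := by
    intro F
    induction F using Finset.induction_on with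
    | empty => simp [hV.empty]
    | insert i F hi ih =>
      rw [Finset.set_biUnion_insert, Finset.sum_insert hi]
      exact (hVsub _ _ (hB i) (F.measurableSet_biUnion fun i _ => hB i)).trans
        (add_le_add (hVE.le_upperCap (hB i)) ih)
  choose F hF using hc
  refine (hV.mono _ _ hG ((s.biUnion F).measurableSet_biUnion fun i _ => hB i)
    (hGA.trans ?_)).trans ((hfin _).trans ((ENNReal.sum_le_tsum _).trans hsum))
  refine Set.iUnion₂_subset fun m hm => (hF m).trans ?_
  exact Set.iUnion₂_subset fun i hi ω hω => Set.mem_iUnion₂.mpr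
    ⟨i, Finset.mem_biUnion.mpr ⟨m, hm, hi⟩, hω⟩

theorem capacity_iUnion_le {V : Set Ω → ℝ≥0∞} (hV : IsCapacity V)
    (hVc : IsCountablySubadditiveCap V) (hVE : 𝓔.Dominates V) (h : 𝓔.HasCover A η) {G : Set Ω}
    (hG : MeasurableSet G) (hGA : G ⊆ ⋃ m, A m) : V G ≤ η := by
  obtain ⟨B, hB, hsum, hc⟩ := h
  exact (hV.mono _ _ hG (MeasurableSet.iUnion hB) (hGA.trans (iUnion_subset_of_finite_cover hc))).trans
    ((hVc B hB).trans ((ENNReal.tsum_le_tsum fun i => hVE.le_upperCap (hB i)).trans hsum))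

theorem outerCap_le (h : 𝓔.HasCover A η) {G : Set Ω} (hGA : G ⊆ ⋃ m, A m) : 𝓔.outerCap G ≤ η := by
  obtain ⟨B, hB, hsum, hc⟩ := h
  exact (iInf₂_le B ⟨hB, hGA.trans (iUnion_subset_of_finite_cover hc)⟩).trans hsum

end HasCover

theorem outerCap_iUnion_eq_zero {A : ℕ → Set Ω} (h : ∀ i, 𝓔.outerCap (A i) = 0) {G : Set Ω}
    (hG : G ⊆ ⋃ i, A i) : 𝓔.outerCap G = 0 := by
  rw [← nonpos_iff_eq_zero]
  refine le_of_forall_gt fun η hη => ?_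
  obtain ⟨η', hη', hsum⟩ := ENNReal.exists_pos_sum_of_countable (ne_of_gt hη) ℕ
  have hcov : ∀ i, ∃ B : ℕ → Set Ω, ((∀ n, MeasurableSet (B n)) ∧ A i ⊆ ⋃ n, B n) ∧
      ∑' n, 𝓔.upperCap (B n) < η' i := by
    intro i
    have h1 : 𝓔.outerCap (A i) < η' i := by rw [h i]; exact_mod_cast hη' i
    simp only [outerCap, iInf_lt_iff] at h1
    obtain ⟨B, hB, h2⟩ := h1
    exact ⟨B, hB, h2⟩
  choose B hB hlt using hcov
  refine lt_of_le_of_lt ?_ hsum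
  refine (iInf₂_le (fun n => B n.unpair.1 n.unpair.2) ⟨fun n => (hB _).1 _, ?_⟩).trans ?_
  · rw [← Equiv.tsum_eq Nat.pairEquiv (fun n => 𝓔.upperCap (B n.unpair.1 n.unpair.2))]
    simp only [Nat.pairEquiv_apply, Function.uncurry_def, Nat.unpair_pair]
    rw [ENNReal.tsum_prod (f := fun i n => 𝓔.upperCap (B i n))]
    exact ENNReal.tsum_le_tsum fun i => (hlt i).le
  · refine hG.trans (Set.iUnion_subset fun i => (hB i).2.trans (Set.iUnion_subset fun n ω hω => ?_))
    exact Set.mem_iUnion.mpr ⟨Nat.pair i n, by simpa using hω⟩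

end SublinearExpectation

/-! ### The one-sided law as a covering statement. -/

namespace SublinearExpectation

variable {Ω : Type*} [MeasurableSpace Ω] {𝓔 : SublinearExpectation Ω} {X : ℕ → Ω → ℝ}

theorem hasCover_tail {V : Set Ω → ℝ≥0∞} (hVE : 𝓔.Dominates V) (hX : ∀ n, 1 ≤ n → X n ∈ 𝓔.H)
    (hX2 : ∀ n, 1 ≤ n → 𝓔.Integ (fun ω => X n ω ^ 2))
    (htail : ∀ ε : ℝ, 0 < ε → ∑' n : ℕ, V {ω | ε * 𝓔.a X (n + 1) ≤ |X (n + 1) ω|} < ⊤)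
    {δ : ℝ} (hδ : 0 < δ) {η : ℝ≥0∞} (hη : 0 < η) {N : ℕ} (hN : 0 < 𝓔.sSq X N) :
    ∃ n₀, N ≤ n₀ ∧ 𝓔.HasCover (fun m => {ω | ∃ j ∈ Finset.Ioc n₀ m, δ * 𝓔.a X j < |X j ω|}) η := by
  -- The level is halved because `upperCap` at a level is compared with `V` at half that level.
  have h1 := ENNReal.tendsto_sum_nat_add _ (htail (δ / 2) (half_pos hδ)).ne
  obtain ⟨n₀, hn₀, hle⟩ := ((eventually_ge_atTop N).and (h1.eventually_le_const hη)).exists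
  refine ⟨n₀, hn₀, fun i => {ω | δ * 𝓔.a X (i + n₀ + 1) < |X (i + n₀ + 1) ω|}, fun i => ?_,
    (ENNReal.tsum_le_tsum fun i => ?_).trans hle, fun m => ⟨Finset.range m, ?_⟩⟩
  · exact measurableSet_lt measurable_const
      (𝓔.measurable_of_mem _ (abs_mem (hX _ (by omega))))
  · have ha := a_pos (hN.trans_le (sSq_mono hX2 (by omega : N ≤ i + n₀ + 1)))
    refine (hVE.upperCap_tail_le (hX (i + n₀ + 1) (by omega)) (by positivity)).trans_eq ?_
    congr 1
    ext ω
    simp only [Set.mem_ofPred_eq]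
    rw [mul_div_right_comm]
  · rintro ω ⟨j, hj, hω⟩
    rw [Finset.mem_Ioc] at hj
    refine Set.mem_iUnion₂.mpr ⟨j - n₀ - 1, Finset.mem_range.mpr (by omega), ?_⟩
    have : j - n₀ - 1 + n₀ + 1 = j := by omega
    simpa only [Set.mem_ofPred_eq, this] using hω

theorem tendsto_a (hs : Tendsto (𝓔.sSq X) atTop atTop) : Tendsto (𝓔.a X) atTop atTop := by
  refine tendsto_atTop_mono (fun n => ?_) (Real.tendsto_sqrt_atTop.comp hs)
  have h1 : 1 ≤ 𝓔.t X n := by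
    refine Real.one_le_sqrt.mpr ?_
    have := one_le_logE (logE (𝓔.sSq X n))
    linarith
  exact le_mul_of_one_le_right (Real.sqrt_nonneg _) h1

theorem eventually_upperCap_le (hs : Tendsto (𝓔.sSq X) atTop atTop) {Y : Ω → ℝ} (hY : 𝓔.Integ Y)
    {c : ℝ} (hc : 0 < c) {η : ℝ≥0∞} (hη : 0 < η) :
    ∀ᶠ n in atTop, 𝓔.upperCap {ω | c * 𝓔.a X n < |Y ω|} ≤ η := by
  have ha := (tendsto_a hs).const_mul_atTop hc
  have h1 : Tendsto (fun n => ENNReal.ofReal (𝓔.ex (fun ω => |Y ω|) / (c * 𝓔.a X n))) atTop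
      (𝓝 0) := by
    rw [← ENNReal.ofReal_zero]
    exact (ENNReal.continuous_ofReal.tendsto 0).comp (ha.const_div_atTop _)
  filter_upwards [h1.eventually_le_const hη, ha.eventually_gt_atTop 0] with n hn hpos
  exact (upperCap_le_div hY.abs hpos (fun ω hω => le_of_lt hω) fun _ => abs_nonneg _).trans hn

theorem measurableSet_truncSum (hX : ∀ n, 1 ≤ n → X n ∈ 𝓔.H) (δ z : ℝ) (n₀ n : ℕ) :
    MeasurableSet {ω | ∃ m ∈ Finset.Icc 1 n, z ≤ 𝓔.truncSum X δ n₀ m ω} := by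
  have : {ω | ∃ m ∈ Finset.Icc 1 n, z ≤ 𝓔.truncSum X δ n₀ m ω} =
      ⋃ m ∈ Finset.Icc 1 n, {ω | z ≤ 𝓔.truncSum X δ n₀ m ω} := by ext; simp
  rw [this]
  refine Finset.measurableSet_biUnion _ fun m _ => measurableSet_le measurable_const ?_
  refine Finset.measurable_fun_sum _ fun j hj => ?_
  rw [Finset.mem_Ioc] at hj
  exact ((𝓔.measurable_of_mem _ (hX j (by omega))).min measurable_const).sub measurable_const

theorem hasCover_blocks (hX : ∀ n, 1 ≤ n → 𝓔.Integ (X n))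
    (hX2 : ∀ n, 1 ≤ n → 𝓔.Integ (fun ω => X n ω ^ 2)) (hindep : 𝓔.IndepSeq X)
    (hs : Tendsto (𝓔.sSq X) atTop atTop)
    {ε α δ p d θ : ℝ} (hα : 0 < α) (hαε : Real.exp α = 1 + ε) (hδ : 0 < δ) (hδ1 : δ ≤ 1)
    (hδd : 4 * δ * (d + 1) ≤ 1) (hd : 0 ≤ d) (hp : 2 ≤ p) (hθ : 1 < θ)
    (hsum : Summable (fun n : ℕ => 𝓔.GammaBar X p (α / 2) (n + 1) / 𝓔.a X (n + 1) ^ p *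
      (𝓔.LambdaBar X p (α / 2) (n + 1) / 𝓔.a X (n + 1) ^ p) ^ d))
    {n₀ : ℕ} (hn₀ : 0 < 𝓔.sSq X n₀) {η : ℝ≥0∞} (hη : 0 < η) :
    ∃ k₁, 𝓔.HasCover (fun m => {ω | θ ^ k₁ ≤ 𝓔.sSq X m ∧ ∃ k, m ∈ block (𝓔.sSq X) θ k ∧
      (1 + ε) * 𝓔.a X (blockEnd (𝓔.sSq X) θ k) ≤ 𝓔.truncSum X δ n₀ m ω}) η := by
  classical
  have hε : 0 < ε := by
    have := Real.add_one_lt_exp hα.ne'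
    linarith
  have hθ0 : 0 < θ := by linarith
  set f := 𝓔.sSq X with hf
  have hmono : Monotone f := sSq_mono hX2
  set e := blockEnd f θ with he
  -- Blocks may be empty when `s_n^2` jumps, and then `e k` is a default value; `n₀ ≤ e k` ensures
  -- that `s_n^2 > 0` at the block end.
  set D : ℕ → Set Ω := fun k => if (block f θ k).Nonempty ∧ n₀ ≤ e k then
    {ω | ∃ m ∈ Finset.Icc 1 (e k), (1 + ε) * 𝓔.a X (e k) ≤ 𝓔.truncSum X δ n₀ m ω} else ∅ with hD
  have hDm : ∀ k, MeasurableSet (D k) := fun k => by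
    simp only [hD]
    split_ifs
    · exact measurableSet_truncSum (fun n hn => (hX n hn).mem) _ _ _ _
    · exact MeasurableSet.empty
  obtain ⟨C, hC, hcap⟩ := exists_upperCap_truncSum_le hX hX2 hindep hα hαε hδ hδ1 hδd
    (by linarith) (by linarith : 1 ≤ p)
  obtain ⟨C', hC', hexp⟩ := exists_exp_neg_logE_le hθ hε
  have hfin := tsum_excessSum_blockEnd_lt_top (fun n hn => (hX n hn).mem) hX2 hs hp
    (half_pos hα).le hd hθ hsum hn₀
  rw [← hf, ← he] at hfin
  have hle : ∀ k, 𝓔.upperCap (D k) ≤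
      ENNReal.ofReal (C * C' * ((k + 1 : ℕ) : ℝ) ^ (-(1 + ε))) + ENNReal.ofReal C *
        (if (block f θ k).Nonempty ∧ n₀ ≤ e k then ENNReal.ofReal ((𝓔.excessSum X p
          (α / 2 * 𝓔.s X (e k) / 𝓔.t X (e k)) (e k) / 𝓔.a X (e k) ^ p) ^ (d + 1)) else 0) := by
    intro k
    simp only [hD]
    split_ifs with h
    · refine (hcap n₀ (e k) (hn₀.trans_le (hmono h.2))).trans ?_
      rw [mul_add, mul_assoc]
      refine ENNReal.ofReal_add_le.trans (add_le_add (ENNReal.ofReal_le_ofReal ?_) ?_)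
      · exact mul_le_mul_of_nonneg_left (hexp k _ (blockEnd_mem hs h.1).1) hC
      · rw [ENNReal.ofReal_mul hC]
    · rw [upperCap_empty]
      exact zero_le
  have htot : ∑' k, 𝓔.upperCap (D k) < ⊤ := by
    refine (ENNReal.tsum_le_tsum hle).trans_lt ?_
    rw [ENNReal.tsum_add, ENNReal.tsum_mul_left]
    have hS : Summable fun k : ℕ => C * C' * ((k + 1 : ℕ) : ℝ) ^ (-(1 + ε)) :=
      ((summable_nat_add_iff 1).mpr
        (Real.summable_nat_rpow.mpr (by linarith : -(1 + ε) < -1))).mul_left _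
    rw [← ENNReal.ofReal_tsum_of_nonneg (fun k => by positivity) hS]
    exact ENNReal.add_lt_top.mpr
      ⟨ENNReal.ofReal_lt_top, ENNReal.mul_lt_top ENNReal.ofReal_lt_top hfin⟩
  -- Besides a small tail, `k₁` is required to satisfy `θ^k₁ > s_{n₀}^2`, so that every relevant
  -- time exceeds `n₀`.
  obtain ⟨k₁, hk₁, htail⟩ := (((tendsto_pow_atTop_atTop_of_one_lt hθ).eventually_gt_atTop
    (f n₀)).and ((ENNReal.tendsto_sum_nat_add _ htot.ne).eventually_le_const hη)).exists
  refine ⟨k₁, fun i => D (i + k₁), fun i => hDm _, htail, fun m => ?_⟩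
  obtain ⟨K, hK⟩ := pow_unbounded_of_one_lt (f m) hθ
  refine ⟨Finset.range K, ?_⟩
  rintro ω ⟨hm, k, hk, hω⟩
  have h1 : k₁ < k + 1 := (pow_lt_pow_iff_right₀ hθ).mp (hm.trans_lt hk.2)
  have h2 : k < K := (pow_lt_pow_iff_right₀ hθ).mp (hk.1.trans_lt hK)
  have h3 : n₀ < m := hmono.reflect_lt (hk₁.trans_le hm)
  have h4 := le_blockEnd hs hk
  refine Set.mem_iUnion₂.mpr ⟨k - k₁, Finset.mem_range.mpr (by omega), ?_⟩
  have h5 : k - k₁ + k₁ = k := by omega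
  simp only [hD, h5]
  rw [if_pos ⟨⟨m, hk⟩, h3.le.trans h4⟩]
  exact ⟨m, Finset.mem_Icc.mpr ⟨by omega, h4⟩, hω⟩

theorem exists_mem_block {f : ℕ → ℝ} {θ : ℝ} (hθ : 1 < θ) {m : ℕ} (h : 1 ≤ f m) :
    ∃ k, m ∈ block f θ k := by
  obtain ⟨k, hk⟩ := exists_nat_pow_near h hθ
  exact ⟨k, hk⟩

/-- The upper half of the law of the iterated logarithm, as a covering statement. -/
theorem hasCover_upper {V : Set Ω → ℝ≥0∞} (hVE : 𝓔.Dominates V) (hX : ∀ n, 1 ≤ n → X n ∈ 𝓔.H)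
    (hindep : 𝓔.IndepSeq X) (hfin : ∀ n, 1 ≤ n → 𝓔.E (fun ω => X n ω ^ 2) < ⊤)
    (hs : Tendsto (fun n => 𝓔.sSq X n) atTop atTop)
    (htail : ∀ ε : ℝ, 0 < ε → ∑' n : ℕ, V {ω | ε * 𝓔.a X (n + 1) ≤ |X (n + 1) ω|} < ⊤)
    (hmoment : ∀ α : ℝ, 0 < α → ∃ p : ℝ, 2 ≤ p ∧ ∃ d : ℝ, 0 ≤ d ∧
      Summable (fun n : ℕ => 𝓔.GammaBar X p α (n + 1) / 𝓔.a X (n + 1) ^ p *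
        (𝓔.LambdaBar X p α (n + 1) / 𝓔.a X (n + 1) ^ p) ^ d))
    {ε : ℝ} (hε : 0 < ε) {η : ℝ≥0∞} (hη : 0 < η) :
    ∃ n₁, 𝓔.HasCover (fun m => {ω | n₁ ≤ m ∧
      1 + ε < (partialSum X m ω - 𝓔.ex (partialSum X m)) / 𝓔.a X m}) η := by
  have hI : ∀ n, 1 ≤ n → 𝓔.Integ (X n) := fun n hn => (Integ.of_sq (hX n hn) (hfin n hn)).1
  have hX2 : ∀ n, 1 ≤ n → 𝓔.Integ (fun ω => X n ω ^ 2) :=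
    fun n hn => (Integ.of_sq (hX n hn) (hfin n hn)).2
  have hmono : Monotone (𝓔.sSq X) := sSq_mono hX2
  -- The margin is split as `θ (1 + ε/4) = 1 + ε/2` for the blocks and `ε/2` for the first `n₀`
  -- summands. The moment condition is taken at `α / 2`, the halved level of the exponential
  -- inequality, and `δ` gives `4δ(d+1) = 1`.
  set α := Real.log (1 + ε / 4) with hα
  have hα0 : 0 < α := Real.log_pos (by linarith)
  have hαε : Real.exp α = 1 + ε / 4 := Real.exp_log (by linarith)
  obtain ⟨p, hp, d, hd, hsum⟩ := hmoment (α / 2) (half_pos hα0)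
  set δ := 1 / (4 * (d + 1)) with hδ
  have hδ0 : 0 < δ := by positivity
  have hδd : 4 * δ * (d + 1) ≤ 1 := by
    rw [hδ]
    apply le_of_eq
    field_simp
  have hδ1 : δ ≤ 1 := by
    rw [hδ, div_le_one (by positivity)]; linarith
  set θ := (1 + ε / 2) / (1 + ε / 4) with hθ
  have hθ1 : 1 < θ := by
    rw [hθ, one_lt_div (by linarith)]; linarith
  have hη3 : 0 < η / 3 := ENNReal.div_pos hη.ne' (by norm_num)
  obtain ⟨N, hN⟩ := (hs.eventually_gt_atTop 0).exists
  obtain ⟨n₀, hn₀, hcov1⟩ := hasCover_tail hVE hX hX2 htail hδ0 hη3 hN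
  have hfn₀ : 0 < 𝓔.sSq X n₀ := hN.trans_le (hmono hn₀)
  obtain ⟨k₁, hcov2⟩ := hasCover_blocks hI hX2 hindep hs hα0 hαε hδ0 hδ1 hδd hd hp hθ1 hsum hfn₀
    hη3
  set Y : Ω → ℝ := fun ω => partialSum X n₀ ω - 𝓔.ex (partialSum X n₀) with hY
  have hYI : 𝓔.Integ Y := (integ_partialSum hI n₀).sub (Integ.const _)
  -- Beyond `n₁` the initial segment is negligible against `a_m`, and `s_m^2 ≥ 1` places `m` in some
  -- block.
  obtain ⟨n₁, hcap, hn₁, hk₁⟩ := ((eventually_upperCap_le hs hYI (half_pos hε) hη3).and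
    ((eventually_ge_atTop n₀).and (hs.eventually_ge_atTop (max 1 (θ ^ k₁))))).exists
  have hcov3 := HasCover.single (measurableSet_lt measurable_const
    (𝓔.measurable_of_mem _ hYI.abs.mem)) hcap
  refine ⟨n₁, ((hcov1.union hcov2).union hcov3).mono (fun m ω hω => ?_)
    (by rw [ENNReal.add_thirds])⟩
  obtain ⟨hm, hω⟩ := hω
  by_contra hnot
  simp only [Set.mem_union, not_or, Set.mem_ofPred_eq, not_exists, not_and, not_lt, not_le] at hnot
  obtain ⟨⟨h1, h2⟩, h3⟩ := hnot
  have hfm : max 1 (θ ^ k₁) ≤ 𝓔.sSq X m := hk₁.trans (hmono hm)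
  obtain ⟨k, hk⟩ := exists_mem_block (f := 𝓔.sSq X) hθ1 ((le_max_left _ _).trans hfm)
  have h4 := h2 ((le_max_right _ _).trans hfm) k hk
  have ham : 0 < 𝓔.a X m := a_pos (one_pos.trans_le ((le_max_left _ _).trans hfm))
  rw [lt_div_iff₀ ham] at hω
  have hsplit : partialSum X m ω - 𝓔.ex (partialSum X m) = Y ω + 𝓔.truncSum X δ n₀ m ω := by
    have hT : 𝓔.truncSum X δ n₀ m ω = ∑ j ∈ Finset.Ioc n₀ m, (X j ω - 𝓔.ex (X j)) := by
      refine Finset.sum_congr rfl fun j hj => ?_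
      rw [min_eq_left ((le_abs_self _).trans (h1 j hj))]
    have hset : ∀ n, Finset.Icc 1 n = Finset.Ioc 0 n := fun n => by
      ext; simp only [Finset.mem_Icc, Finset.mem_Ioc]; omega
    rw [hT, hY]
    simp only [ex_partialSum hI hindep, partialSum, hset, Finset.sum_sub_distrib]
    rw [← Finset.sum_Ioc_consecutive _ (Nat.zero_le n₀) (hn₁.trans hm),
      ← Finset.sum_Ioc_consecutive _ (Nat.zero_le n₀) (hn₁.trans hm)]
    ring
  have hYle : Y ω ≤ ε / 2 * 𝓔.a X m :=
    (le_abs_self _).trans (h3.trans (by gcongr; exact a_mono hX2 hm))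
  have hblock : 𝓔.a X (blockEnd (𝓔.sSq X) θ k) ≤ θ * 𝓔.a X m := by
    refine a_le_mul hX2 hθ1.le ?_
    have h5 := (blockEnd_mem hs ⟨m, hk⟩).2
    have h6 := hk.1
    rw [pow_succ'] at h5
    exact h5.le.trans (by gcongr)
  have h7 : (1 + ε / 4) * 𝓔.a X (blockEnd (𝓔.sSq X) θ k) ≤ (1 + ε / 2) * 𝓔.a X m := by
    calc _ ≤ (1 + ε / 4) * (θ * 𝓔.a X m) := by gcongr
      _ = _ := by rw [hθ]; field_simp
  rw [hsplit] at hω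
  linarith

end SublinearExpectation

/-! ### Reflection and the two-sided exceedance events. -/

namespace SublinearExpectation

theorem partialSum_neg {Ω : Type*} {X : ℕ → Ω → ℝ} (m : ℕ) :
    partialSum (fun n ω => -X n ω) m = fun ω => -partialSum X m ω := by
  ext ω; simp [partialSum]

variable {Ω : Type*} [MeasurableSpace Ω] {𝓔 : SublinearExpectation Ω} {X : ℕ → Ω → ℝ}

theorem locLip_comp_neg {F : Type*} [SeminormedAddCommGroup F] {φ : F → ℝ} (h : LocLip φ) :
    LocLip (fun x => φ (-x)) := by
  obtain ⟨C, hC, m, h⟩ := h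
  refine ⟨C, hC, m, fun x y => ?_⟩
  have := h (-x) (-y)
  rwa [norm_neg, norm_neg, neg_sub_neg, norm_sub_rev] at this

theorem IndepSeq.neg (h : 𝓔.IndepSeq X) : 𝓔.IndepSeq (fun n ω => -X n ω) :=
  fun i hi φ hφ h1 h2 h3 h4 => h i hi (fun z => φ (-z)) (locLip_comp_neg hφ)
    (fun x => h1 (-x)) h2 h3 h4

theorem sSq_neg : 𝓔.sSq (fun n ω => -X n ω) = 𝓔.sSq X := by
  ext n; simp [sSq]

theorem s_neg : 𝓔.s (fun n ω => -X n ω) = 𝓔.s X := by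
  ext n; simp [s, sSq_neg]

theorem t_neg : 𝓔.t (fun n ω => -X n ω) = 𝓔.t X := by
  ext n; simp [t, sSq_neg]

theorem a_neg : 𝓔.a (fun n ω => -X n ω) = 𝓔.a X := by
  ext n; simp [a, s_neg, t_neg]

theorem truncMoment_neg (p α : ℝ) (n j : ℕ) :
    𝓔.truncMoment (fun n ω => -X n ω) p α n j = 𝓔.truncMoment X p α n j := by
  simp [truncMoment, s_neg, t_neg, a_neg]

/-- The two-sided exceedance event at time `m`. -/
def exceed (𝓔 : SublinearExpectation Ω) (X : ℕ → Ω → ℝ) (ε : ℝ) (m : ℕ) : Set Ω :=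
  {ω | 𝓔.lowerRatio X m ω < ((-1 - ε : ℝ) : EReal) ∨ ((1 + ε : ℝ) : EReal) < 𝓔.upperRatio X m ω}

/-- The hypotheses and normalizers are invariant under `X ↦ -X`, which exchanges the two centrings
up to sign; so the lower half is the upper half for `-X`. -/
theorem hasCover_exceed {V : Set Ω → ℝ≥0∞} (hVE : 𝓔.Dominates V) (hX : ∀ n, 1 ≤ n → X n ∈ 𝓔.H)
    (hindep : 𝓔.IndepSeq X) (hfin : ∀ n, 1 ≤ n → 𝓔.E (fun ω => X n ω ^ 2) < ⊤)
    (hs : Tendsto (fun n => 𝓔.sSq X n) atTop atTop)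
    (htail : ∀ ε : ℝ, 0 < ε → ∑' n : ℕ, V {ω | ε * 𝓔.a X (n + 1) ≤ |X (n + 1) ω|} < ⊤)
    (hmoment : ∀ α : ℝ, 0 < α → ∃ p : ℝ, 2 ≤ p ∧ ∃ d : ℝ, 0 ≤ d ∧
      Summable (fun n : ℕ => 𝓔.GammaBar X p α (n + 1) / 𝓔.a X (n + 1) ^ p *
        (𝓔.LambdaBar X p α (n + 1) / 𝓔.a X (n + 1) ^ p) ^ d))
    {ε : ℝ} (hε : 0 < ε) {η : ℝ≥0∞} (hη : 0 < η) :
    ∃ n₁, 𝓔.HasCover (fun m => {ω | n₁ ≤ m ∧ ω ∈ 𝓔.exceed X ε m}) η := by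
  have hη2 : 0 < η / 2 := ENNReal.half_pos hη.ne'
  obtain ⟨n₁, h₁⟩ := hasCover_upper hVE hX hindep hfin hs htail hmoment hε hη2
  obtain ⟨n₂, h₂⟩ := hasCover_upper (X := fun n ω => -X n ω) hVE (fun n hn => neg_mem' (hX n hn))
    hindep.neg (fun n hn => by simpa using hfin n hn) (by simpa only [sSq_neg] using hs)
    (by simpa only [a_neg, abs_neg] using htail)
    (by simpa only [GammaBar, LambdaBar, truncMoment_neg, a_neg] using hmoment) hε hη2
  refine ⟨max n₁ n₂, (h₁.union h₂).mono (fun m ω hω => ?_) (by rw [ENNReal.add_halves])⟩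
  obtain ⟨hm, hω | hω⟩ := hω
  · refine Or.inr ⟨(le_max_right _ _).trans hm, ?_⟩
    rw [lowerRatio, EReal.coe_lt_coe_iff] at hω
    rw [partialSum_neg, a_neg]
    have h3 : (partialSum X m ω - 𝓔.cex (partialSum X m)) / 𝓔.a X m =
        -((-partialSum X m ω - 𝓔.ex (fun ω => -partialSum X m ω)) / 𝓔.a X m) := by
      rw [cex, ex]; ring
    rw [h3] at hω
    linarith
  · refine Or.inl ⟨(le_max_left _ _).trans hm, ?_⟩
    rwa [upperRatio, EReal.coe_lt_coe_iff] at hω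

theorem measurable_ratios (hX : ∀ n, 1 ≤ n → X n ∈ 𝓔.H) (m : ℕ) :
    Measurable (𝓔.lowerRatio X m) ∧ Measurable (𝓔.upperRatio X m) := by
  have h : Measurable (partialSum X m) := Finset.measurable_fun_sum _ fun j hj =>
    𝓔.measurable_of_mem _ (hX j (Finset.mem_Icc.mp hj).1)
  exact ⟨measurable_coe_real_ereal.comp ((h.sub_const _).div_const _),
    measurable_coe_real_ereal.comp ((h.sub_const _).div_const _)⟩

theorem measurableSet_exceed (hX : ∀ n, 1 ≤ n → X n ∈ 𝓔.H) (s : Set ℕ) (ε : ℝ) :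
    MeasurableSet {ω | (⨅ m ∈ s, 𝓔.lowerRatio X m ω) < ((-1 - ε : ℝ) : EReal) ∨
      ((1 + ε : ℝ) : EReal) < ⨆ m ∈ s, 𝓔.upperRatio X m ω} :=
  (measurableSet_lt (Measurable.biInf s s.to_countable fun m _ => (measurable_ratios hX m).1)
    measurable_const).union (measurableSet_lt measurable_const
      (Measurable.biSup s s.to_countable fun m _ => (measurable_ratios hX m).2))

theorem exists_mem_exceed {s : Set ℕ} {ε : ℝ} {ω : Ω}
    (h : (⨅ m ∈ s, 𝓔.lowerRatio X m ω) < ((-1 - ε : ℝ) : EReal) ∨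
      ((1 + ε : ℝ) : EReal) < ⨆ m ∈ s, 𝓔.upperRatio X m ω) :
    ∃ m ∈ s, ω ∈ 𝓔.exceed X ε m := by
  rcases h with h | h
  · simp only [iInf_lt_iff] at h
    obtain ⟨m, hm, h⟩ := h
    exact ⟨m, hm, Or.inl h⟩
  · simp only [lt_iSup_iff] at h
    obtain ⟨m, hm, h⟩ := h
    exact ⟨m, hm, Or.inr h⟩

/-- A strict inequality leaves a gap larger than some `1 / (i + 1)`, so the limit event is a
countable union of events of infinitely frequent exceedance. -/
theorem exists_frequently_exceed {ω : Ω}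
    (h : liminf (fun n => 𝓔.lowerRatio X n ω) atTop < ((-1 : ℝ) : EReal) ∨
      ((1 : ℝ) : EReal) < limsup (fun n => 𝓔.upperRatio X n ω) atTop) :
    ∃ i : ℕ, ∃ᶠ m in atTop, ω ∈ 𝓔.exceed X (1 / ((i : ℝ) + 1)) m := by
  rcases h with h | h
  · obtain ⟨x, h1, h2⟩ := EReal.lt_iff_exists_real_btwn.mp h
    rw [EReal.coe_lt_coe_iff] at h2
    obtain ⟨i, hi⟩ := exists_nat_one_div_lt (by linarith : 0 < -1 - x)
    refine ⟨i, (frequently_lt_of_liminf_lt (by isBoundedDefault) h1).mono fun m hm => Or.inl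
      (hm.trans ?_)⟩
    rw [EReal.coe_lt_coe_iff]
    linarith
  · obtain ⟨x, h1, h2⟩ := EReal.lt_iff_exists_real_btwn.mp h
    rw [EReal.coe_lt_coe_iff] at h1
    obtain ⟨i, hi⟩ := exists_nat_one_div_lt (by linarith : 0 < x - 1)
    refine ⟨i, (frequently_lt_of_lt_limsup (by isBoundedDefault) h2).mono fun m hm => Or.inr
      (lt_trans ?_ hm)⟩
    rw [EReal.coe_lt_coe_iff]
    linarith

end SublinearExpectation

/-! ### The three conclusions from a single covering. -/

theorem mainTheorem1 {Ω : Type*} [MeasurableSpace Ω] (𝓔 : SublinearExpectation Ω)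
    (V : Set Ω → ℝ≥0∞) (hV : IsCapacity V) (hVsub : IsSubadditiveCap V)
    (hVE : 𝓔.Dominates V)
    (X : ℕ → Ω → ℝ) (hX : ∀ n, 1 ≤ n → X n ∈ 𝓔.H) (hindep : 𝓔.IndepSeq X)
    (hfin : ∀ n, 1 ≤ n → 𝓔.E (fun ω => X n ω ^ 2) < ⊤)
    (hs : Tendsto (fun n => 𝓔.sSq X n) atTop atTop)
    (htail : ∀ ε : ℝ, 0 < ε →
      ∑' n : ℕ, V {ω | ε * 𝓔.a X (n + 1) ≤ |X (n + 1) ω|} < ⊤)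
    (hmoment : ∀ α : ℝ, 0 < α → ∃ p : ℝ, 2 ≤ p ∧ ∃ d : ℝ, 0 ≤ d ∧
      Summable (fun n : ℕ =>
        𝓔.GammaBar X p α (n + 1) / 𝓔.a X (n + 1) ^ p *
          (𝓔.LambdaBar X p α (n + 1) / 𝓔.a X (n + 1) ^ p) ^ d)) :
    (∀ ε : ℝ, 0 < ε →
      Tendsto (fun n : ℕ => ⨆ N : ℕ,
        V {ω | (⨅ m ∈ Set.Icc n N, 𝓔.lowerRatio X m ω) < ((-1 - ε : ℝ) : EReal) ∨
          ((1 + ε : ℝ) : EReal) < ⨆ m ∈ Set.Icc n N, 𝓔.upperRatio X m ω})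
        atTop (𝓝 0)) ∧
    (IsCountablySubadditiveCap V → ∀ ε : ℝ, 0 < ε →
      Tendsto (fun n : ℕ =>
        V {ω | (⨅ m ∈ Set.Ici n, 𝓔.lowerRatio X m ω) < ((-1 - ε : ℝ) : EReal) ∨
          ((1 + ε : ℝ) : EReal) < ⨆ m ∈ Set.Ici n, 𝓔.upperRatio X m ω})
        atTop (𝓝 0)) ∧
    𝓔.outerCap {ω | liminf (fun n => 𝓔.lowerRatio X n ω) atTop < ((-1 : ℝ) : EReal) ∨
      ((1 : ℝ) : EReal) < limsup (fun n => 𝓔.upperRatio X n ω) atTop} = 0 := by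

  have hcov := fun {ε : ℝ} (hε : 0 < ε) {η : ℝ≥0∞} (hη : 0 < η) =>
    SublinearExpectation.hasCover_exceed hVE hX hindep hfin hs htail hmoment hε hη
  refine ⟨fun ε hε => ?_, fun hVc ε hε => ?_, ?_⟩
  · rw [ENNReal.tendsto_atTop_zero]
    intro η hη
    obtain ⟨n₁, h⟩ := hcov hε hη
    refine ⟨n₁, fun n hn => iSup_le fun N => h.capacity_le hV hVsub hVE
      (SublinearExpectation.measurableSet_exceed hX _ ε) (s := Finset.Icc n N) fun ω hω => ?_⟩
    obtain ⟨m, hm, hωm⟩ := SublinearExpectation.exists_mem_exceed hω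
    exact Set.mem_iUnion₂.mpr ⟨m, Finset.mem_Icc.mpr hm, hn.trans hm.1, hωm⟩
  · rw [ENNReal.tendsto_atTop_zero]
    intro η hη
    obtain ⟨n₁, h⟩ := hcov hε hη
    refine ⟨n₁, fun n hn => h.capacity_iUnion_le hV hVc hVE
      (SublinearExpectation.measurableSet_exceed hX _ ε) fun ω hω => ?_⟩
    obtain ⟨m, hm, hωm⟩ := SublinearExpectation.exists_mem_exceed hω
    exact Set.mem_iUnion.mpr ⟨m, hn.trans hm, hωm⟩
  · refine SublinearExpectation.outerCap_iUnion_eq_zero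
      (A := fun i => {ω | ∃ᶠ m in atTop, ω ∈ 𝓔.exceed X (1 / ((i : ℝ) + 1)) m}) (fun i => ?_)
      fun ω hω => Set.mem_iUnion.mpr (SublinearExpectation.exists_frequently_exceed hω)
    rw [← nonpos_iff_eq_zero]
    refine le_of_forall_gt_imp_ge_of_dense fun η hη => ?_
    obtain ⟨n₁, h⟩ := hcov (by positivity : 0 < 1 / ((i : ℝ) + 1)) hη
    refine h.outerCap_le fun ω hω => ?_
    obtain ⟨m, hm, hωm⟩ := frequently_atTop.mp hω n₁
    exact Set.mem_iUnion.mpr ⟨m, hm, hωm⟩
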